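/- Let $n\ge 0$, let $\widehat{\mathcal O}=\mathbb C[\![x_1,\dots,x_n]\!]$ with maximal ideal $\mathfrak m=\langle x_1,\dots,x_n\rangle$, and let $\mathrm{Der}$ be the $\widehat{\mathcal O}$-module of $\mathbb C$-linear derivations of $\widehat{\mathcal O}$. For $0\ne f\in\widehat{\mathcal O}$ put $\mathrm{Der}_f=\{\delta\in\mathrm{Der}\mid \delta(\widehat{\mathcal O}f)\subseteq\widehat{\mathcal O}f\}$, a Lie algebra over $\mathbb C$ under the commutator bracket. Assume that $f$ is not a product, that is, $\mathrm{Der}_f\subseteq\mathfrak m\cdot\mathrm{Der}$. For $d\ge1$ let $\mathfrak D_d$ be the Lie algebra $\mathrm{Der}_f/\mathfrak m^d\cdot\mathrm{Der}_f$ over $\mathbb C$. A derivation $\sigma$ is called diagonal if $\sigma=\sum_i w_ix_i\partial_i$ with $w_1,\dots,w_n\in\mathbb C$. Let $s$ be the maximum, over all $g$ obtained from $f$ by a formal change of coordinates and multiplication by a unit of $\widehat{\mathcal O}$, of the dimension of the complex vector space of diagonal $\sigma\in\mathrm{Der}_g$ with $\sigma(g)\in\mathbb C\cdot g$. Let $r$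 be the number such that the minimal systems of generators of the $\widehat{\mathcal O}$-module $\mathrm{Der}_f$ have $s+r$ elements. If $r\le1$ or $s=0$, then the Lie algebras $\mathfrak D_d$ are solvable for all $d\ge1$. In particular, all $\mathfrak D_d$ are solvable if $\mathrm{Der}_f$ is a free $\widehat{\mathcal O}$-module of rank $2$. -/

import Mathlib

/-- The module `Der_f` of logarithmic vector fields over a commutative `ℂ`-algebra `A`: the
`ℂ`-linear derivations `δ` of `A` that map the ideal `⟨f⟩` into itself. -/
def logDer {A : Type} [CommRing A] [Algebra ℂ A] (f : A) : Submodule A (Derivation ℂ A A) where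
  carrier := {δ | ∀ g ∈ Ideal.span {f}, δ g ∈ Ideal.span {f}}
  add_mem' := fun ha hb g hg => Ideal.add_mem _ (ha g hg) (hb g hg)
  zero_mem' := fun _ _ => Ideal.zero_mem _
  smul_mem' := fun c _ ha g hg => Ideal.mul_mem_left _ c (ha g hg)

/-- `Der_f` as a Lie algebra over `ℂ`, with the commutator bracket of vector fields. -/
def logDerLie {A : Type} [CommRing A] [Algebra ℂ A] (f : A) :
    LieSubalgebra ℂ (Derivation ℂ A A) where
  toSubmodule := (logDer f).restrictScalars ℂ
  lie_mem' := by
    intro δ η hδ hη g hg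
    rw [Derivation.commutator_apply]
    exact Ideal.sub_mem _ (hδ _ (hη g hg)) (hη _ (hδ g hg))

theorem apply_mem_of_mem_smul_top {A : Type} [CommRing A] [Algebra ℂ A] {I : Ideal A}
    {δ : Derivation ℂ A A} (hδ : δ ∈ I • (⊤ : Submodule A (Derivation ℂ A A))) (g : A) :
    δ g ∈ I := by
  induction hδ using Submodule.smul_induction_on' with
  | smul a ha η _ => exact Ideal.mul_mem_right _ _ ha
  | add η _ θ _ h1 h2 => exact Ideal.add_mem _ h1 h2

theorem apply_mem_pow_of_mem_smul_top {A : Type} [CommRing A] [Algebra ℂ A] {I : Ideal A}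
    {δ : Derivation ℂ A A} (hδ : δ ∈ I • (⊤ : Submodule A (Derivation ℂ A A))) (d : ℕ) :
    ∀ g ∈ I ^ d, δ g ∈ I ^ d := by
  induction d with
  | zero => intro g _; simp
  | succ d ih =>
    intro g hg
    rw [pow_succ] at hg ⊢
    induction hg using Submodule.mul_induction_on' with
    | mem_mul_mem a ha b hb =>
      rw [Derivation.leibniz, smul_eq_mul, smul_eq_mul, mul_comm b]
      exact Ideal.add_mem _ (Ideal.mul_mem_mul ha (apply_mem_of_mem_smul_top hδ b))
        (Ideal.mul_mem_mul (ih a ha) hb)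
    | add a _ b _ h1 h2 => rw [map_add]; exact Ideal.add_mem _ h1 h2

/-- The Lie ideal `I ^ d · Der_f` of `Der_f`, in case `Der_f ⊆ I · Der`. -/
def truncIdeal {A : Type} [CommRing A] [Algebra ℂ A] (f : A) (I : Ideal A)
    (hf : logDer f ≤ I • (⊤ : Submodule A (Derivation ℂ A A))) (d : ℕ) :
    LieIdeal ℂ (logDerLie f) where
  toSubmodule :=
    ((I ^ d • logDer f).restrictScalars ℂ).comap (logDerLie f).toSubmodule.subtype
  lie_mem := by
    rintro ⟨η, hη⟩ ⟨δ, hδ'⟩ hδ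
    change δ ∈ I ^ d • logDer f at hδ
    change ⁅η, δ⁆ ∈ I ^ d • logDer f
    clear hδ'
    induction hδ using Submodule.smul_induction_on' with
    | smul a ha θ hθ =>
      have key : ⁅η, a • θ⁆ = a • ⁅η, θ⁆ + η a • θ := by
        refine Derivation.ext fun g => ?_
        simp only [Derivation.commutator_apply, Derivation.coe_smul, Derivation.coe_add,
          Pi.smul_apply, Pi.add_apply, Derivation.leibniz, smul_eq_mul]
        ring
      rw [key]
      exact Submodule.add_mem _
        (Submodule.smul_mem_smul ha ((logDerLie f).lie_mem hη hθ))
        (Submodule.smul_mem_smul (apply_mem_pow_of_mem_smul_top (hf hη) d a ha) hθ)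
    | add a _ b _ h1 h2 => rw [lie_add]; exact Submodule.add_mem _ h1 h2

/-- The ring `ℂ⟦x₁, …, xₙ⟧` of formal power series in `n` variables. -/
abbrev FormalSeries (n : ℕ) : Type := MvPowerSeries (Fin n) ℂ

/-- The module `Der` of formal vector fields: all `ℂ`-linear derivations of `ℂ⟦x₁, …, xₙ⟧`. -/
abbrev FormalDer (n : ℕ) : Type := Derivation ℂ (FormalSeries n) (FormalSeries n)

/-- The maximal ideal `𝔪 = ⟨x₁, …, xₙ⟩`. -/
noncomputable def maxIdeal (n : ℕ) : Ideal (FormalSeries n) :=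
  Ideal.span (Set.range fun i : Fin n => (MvPowerSeries.X i : FormalSeries n))

/-- `f` is a product (with a smooth factor) if `Der_f` is not contained in `𝔪 · Der`. -/
def IsProduct {n : ℕ} (f : FormalSeries n) : Prop :=
  ¬ logDer f ≤ maxIdeal n • (⊤ : Submodule (FormalSeries n) (FormalDer n))

/-- The Lie algebra `𝔇_d = Der_f / 𝔪 ^ d · Der_f` over `ℂ`, for `f` that is not a product. -/
abbrev TruncLie {n : ℕ} (f : FormalSeries n) (hf : ¬ IsProduct f) (d : ℕ) : Type :=
  logDerLie f ⧸ truncIdeal f (maxIdeal n) (not_not.mp hf) d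

/-- `σ` is diagonal if `σ = ∑ wᵢ xᵢ ∂ᵢ` with `wᵢ ∈ ℂ`. A derivation of `ℂ⟦x₁, …, xₙ⟧` is
determined by its values on the variables, so this says that `σ(xᵢ) = wᵢ xᵢ` for all `i`. -/
def IsDiagonal {n : ℕ} (σ : FormalDer n) : Prop :=
  ∃ w : Fin n → ℂ, ∀ i, σ (MvPowerSeries.X i) = w i • (MvPowerSeries.X i : FormalSeries n)

/-- The complex vector space of the diagonal `σ ∈ Der_f` with `σ(f) ∈ ℂ · f`. -/
noncomputable def diagFields {n : ℕ} (f : FormalSeries n) : Submodule ℂ (FormalDer n) where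
  carrier := {σ | σ ∈ logDer f ∧ IsDiagonal σ ∧ ∃ c : ℂ, σ f = c • f}
  add_mem' := by
    rintro σ τ ⟨h1, ⟨w, hw⟩, c, hc⟩ ⟨h2, ⟨v, hv⟩, e, he⟩
    refine ⟨Submodule.add_mem _ h1 h2, ⟨w + v, fun i => ?_⟩, c + e, ?_⟩
    · rw [Derivation.add_apply, hw, hv, Pi.add_apply, add_smul]
    · rw [Derivation.add_apply, hc, he, add_smul]
  zero_mem' := ⟨Submodule.zero_mem _, ⟨0, fun i => by simp⟩, 0, by simp⟩
  smul_mem' := by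
    rintro a σ ⟨h1, ⟨w, hw⟩, c, hc⟩
    refine ⟨((logDer f).restrictScalars ℂ).smul_mem a h1, ⟨a • w, fun i => ?_⟩, a * c, ?_⟩
    · rw [Derivation.smul_apply, hw, Pi.smul_apply, smul_assoc]
    · rw [Derivation.smul_apply, hc, mul_smul]

/-- `f` and `g` are formally contact equivalent: `g` is obtained from `f` by a change of
coordinates (an automorphism of the `ℂ`-algebra `ℂ⟦x₁, …, xₙ⟧`) and multiplication by a unit. -/
def ContactEquiv {n : ℕ} (f g : FormalSeries n) : Prop :=
  ∃ (φ : FormalSeries n ≃ₐ[ℂ] FormalSeries n) (u : (FormalSeries n)ˣ), g = u * φ f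

/-- `s` is the maximal dimension of the space of diagonal `σ ∈ Der_g` with `σ(g) ∈ ℂ · g`, for
`g` varying in the formal contact equivalence class of `f`. -/
def IsMaxMultihomogeneity {n : ℕ} (f : FormalSeries n) (s : ℕ) : Prop :=
  IsGreatest {k : ℕ | ∃ g, ContactEquiv f g ∧ k = Module.finrank ℂ (diagFields g)} s

/-- `δ₁, …, δₖ` is a minimal system of generators of `Der_f`: it generates `Der_f`, and no
member can be left out. -/
def IsMinimalGenerators {n k : ℕ} (f : FormalSeries n) (δ : Fin k → FormalDer n) : Prop :=
  Submodule.span (FormalSeries n) (Set.range δ) = logDer f ∧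
    ∀ i, Submodule.span (FormalSeries n) (δ '' {i}ᶜ) ≠ logDer f

/-! Two independent mechanisms give solvability.

If `s = 0`, every logarithmic field is nilpotent on jets. As `f` is not a product, a field `δ` in
`Der_f` preserves each power of `𝔪`, so a formal Jordan decomposition is available: some coordinates
are generalized eigenvectors of `δ` modulo every power of `𝔪`, with weights `w`
(`exists_genEigen_coordinates`), and so is some unit multiple of `f`
(`exists_unit_mul_isFormalGenEigen`). Only monomials of one weight occur in that multiple, so the
diagonal field with weights `w` scales it. Hence `w = 0` when no such nonzero diagonal field exists.
By Engel's theorem the Lie algebra of `k`-jets is then solvable, and by Artin–Rees a field whose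
coordinate values lie in a high power of `𝔪` lies in `𝔪 ^ d · Der_f`.

If `r ≤ 1`, it suffices to treat `𝔇_1`, because bracketing with `𝔪 · Der_f` raises the `𝔪`-adic
filtration of `Der_f`. The dimension of `𝔇_1` is at most `s + r`, and the diagonal fields embed in
it as an abelian subalgebra of dimension `s`. An abelian subalgebra plus a line is a metabelian Lie
algebra (`LieAlgebra.isSolvable_of_abelian_add_line`).

In rank `2`, either there are no diagonal fields, or one of them already accounts for all but one
generator. -/

/-! ### The `𝔪`-adic filtration: orders, limits, truncations -/

/-- The formal power series with prescribed coefficients. -/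
noncomputable def seriesOfCoeff {n : ℕ} (c : (Fin n →₀ ℕ) → ℂ) : FormalSeries n := c

theorem coeff_seriesOfCoeff {n : ℕ} (c : (Fin n →₀ ℕ) → ℂ) (α : Fin n →₀ ℕ) :
    MvPowerSeries.coeff α (seriesOfCoeff c) = c α := rfl

-- Each nonconstant monomial is assigned to one variable dividing it; `h i` collects the monomials
-- assigned to `i`, divided by that variable.
open MvPowerSeries in
theorem exists_eq_sum_X_mul {n : ℕ} (k : ℕ) (g : FormalSeries n)
    (hg : ∀ α : Fin n →₀ ℕ, α.degree < k + 1 → coeff α g = 0) :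
    ∃ h : Fin n → FormalSeries n, g = ∑ i, X i * h i ∧
      ∀ i, ∀ α : Fin n →₀ ℕ, α.degree < k → coeff α (h i) = 0 := by
  classical
  have hex : ∀ α : Fin n →₀ ℕ, ∃ i : Fin n → Prop, (∀ j, i j → α j ≠ 0) ∧
      (α ≠ 0 → ∃ j, i j ∧ ∀ j', i j' → j' = j) := by
    intro α
    by_cases h : α = 0
    · exact ⟨fun _ => False, by simp, fun h' => absurd h h'⟩
    · obtain ⟨j, hj⟩ := Finsupp.ne_iff.mp h
      exact ⟨fun i => i = j, by rintro _ rfl; simpa using hj, fun _ => ⟨j, rfl, fun _ h => h⟩⟩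
  choose c hc1 hc2 using hex
  refine ⟨fun i => seriesOfCoeff fun β =>
    if c (β + Finsupp.single i 1) i then coeff (β + Finsupp.single i 1) g else 0, ?_, ?_⟩
  · ext α
    rw [map_sum]
    have : ∀ i : Fin n, coeff α ((X i : FormalSeries n) * (seriesOfCoeff fun β =>
        if c (β + Finsupp.single i 1) i then coeff (β + Finsupp.single i 1) g else 0)) =
        if c α i then coeff α g else 0 := by
      intro i
      rw [X_def, coeff_monomial_mul]
      split_ifs with h1 h2 h2
      · rw [one_mul, coeff_seriesOfCoeff, tsub_add_cancel_of_le h1, if_pos h2]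
      · rw [one_mul, coeff_seriesOfCoeff, tsub_add_cancel_of_le h1, if_neg h2]
      · exact absurd (Finsupp.single_le_iff.mpr (Nat.one_le_iff_ne_zero.mpr (hc1 α i h2))) h1
      · rfl
    simp_rw [this]
    by_cases h0 : α = 0
    · rw [hg α (by simp [h0])]; simp
    · obtain ⟨j, hj, hu⟩ := hc2 α h0
      rw [Finset.sum_eq_single j, if_pos hj]
      · intro b _ hb; rw [if_neg]; exact fun h => hb (hu b h)
      · simp
  · intro i α hα
    rw [coeff_seriesOfCoeff]
    split_ifs
    · apply hg; simpa using hα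
    · rfl

open MvPowerSeries in
theorem mem_maxIdeal_pow_iff {n : ℕ} (k : ℕ) (g : FormalSeries n) :
    g ∈ maxIdeal n ^ k ↔ ∀ α : Fin n →₀ ℕ, α.degree < k → coeff α g = 0 := by
  constructor
  · intro h
    have hm : ∀ b ∈ maxIdeal n, (1 : ℕ∞) ≤ order b := by
      intro b hb
      rw [one_le_order_iff_constCoeff_eq_zero]
      change b ∈ RingHom.ker (constantCoeff (σ := Fin n) (R := ℂ))
      refine (Ideal.span_le.mpr ?_) hb
      rintro _ ⟨i, rfl⟩
      simp
    have : (k : ℕ∞) ≤ order g := by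
      induction k generalizing g with
      | zero => simp
      | succ k ih =>
        rw [pow_succ] at h
        induction h using Submodule.mul_induction_on' with
        | mem_mul_mem a ha b hb =>
          refine le_trans ?_ le_order_mul
          push_cast
          exact add_le_add (ih a ha) (hm b hb)
        | add a _ b _ h1 h2 => exact le_trans (le_min h1 h2) min_order_le_add
    exact fun α hα => coeff_of_lt_order (lt_of_lt_of_le (by exact_mod_cast hα) this)
  · intro h
    induction k generalizing g with
    | zero => simp
    | succ k ih =>
      obtain ⟨q, rfl, hq⟩ := exists_eq_sum_X_mul k g h
      refine Ideal.sum_mem _ fun i _ => ?_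
      rw [pow_succ']
      exact Ideal.mul_mem_mul (Ideal.subset_span ⟨i, rfl⟩) (ih _ (hq i))

theorem X_mem_maxIdeal {n : ℕ} (i : Fin n) : (MvPowerSeries.X i : FormalSeries n) ∈ maxIdeal n :=
  Ideal.subset_span ⟨i, rfl⟩

theorem mem_maxIdeal_iff {n : ℕ} (g : FormalSeries n) :
    g ∈ maxIdeal n ↔ MvPowerSeries.constantCoeff g = 0 := by
  rw [← pow_one (maxIdeal n), mem_maxIdeal_pow_iff]
  constructor
  · intro h; simpa using h 0 (by simp)
  · intro h α hα
    have : α = 0 := by rwa [Nat.lt_one_iff, Finsupp.degree_eq_zero_iff] at hα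
    simpa [this] using h

theorem mem_maxIdeal_iff_not_isUnit {n : ℕ} (g : FormalSeries n) :
    g ∈ maxIdeal n ↔ ¬ IsUnit g := by
  rw [mem_maxIdeal_iff, MvPowerSeries.isUnit_iff_constantCoeff, isUnit_iff_ne_zero, not_not]

theorem sub_constantCoeff_mem_maxIdeal {n : ℕ} (g : FormalSeries n) :
    g - algebraMap ℂ _ (MvPowerSeries.constantCoeff g) ∈ maxIdeal n := by
  rw [mem_maxIdeal_iff, map_sub, MvPowerSeries.algebraMap_apply, MvPowerSeries.constantCoeff_C]
  simp

theorem eq_zero_of_forall_mem_maxIdeal_pow {n : ℕ} {g : FormalSeries n}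
    (h : ∀ k, g ∈ maxIdeal n ^ k) : g = 0 := by
  ext α
  exact (mem_maxIdeal_pow_iff _ g).mp (h (α.degree + 1)) α (Nat.lt_succ_self _)

/-- Completeness: the coefficient at `α` no longer changes from index `α.degree + 1` on, whatever
`j` is, so it can be read off there. -/
theorem exists_limit {n : ℕ} (v : ℕ → FormalSeries n) (j : ℕ)
    (hv : ∀ i, v (i + 1) - v i ∈ maxIdeal n ^ (j + i)) :
    ∃ g, ∀ i, g - v i ∈ maxIdeal n ^ (j + i) := by
  have key : ∀ i l, v (i + l) - v i ∈ maxIdeal n ^ (j + i) := by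
    intro i l
    induction l with
    | zero => simp
    | succ l ih =>
      have h1 := Ideal.pow_le_pow_right (Nat.le_add_right (j + i) l) (by
        simpa [add_assoc] using hv (i + l))
      have := Ideal.add_mem _ h1 ih
      rwa [sub_add_sub_cancel] at this
  refine ⟨seriesOfCoeff fun α => MvPowerSeries.coeff α (v (α.degree + 1)), fun i => ?_⟩
  rw [mem_maxIdeal_pow_iff]
  intro α hα
  rw [map_sub, sub_eq_zero, coeff_seriesOfCoeff]
  rcases le_total (α.degree + 1) i with h | h
  · obtain ⟨l, rfl⟩ := Nat.exists_eq_add_of_le h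
    have := (mem_maxIdeal_pow_iff _ _).mp (key (α.degree + 1) l) α (by omega)
    rw [map_sub, sub_eq_zero] at this
    exact this.symm
  · obtain ⟨l, hl⟩ := Nat.exists_eq_add_of_le h
    have := (mem_maxIdeal_pow_iff _ _).mp (key i l) α hα
    rwa [map_sub, sub_eq_zero, ← hl] at this

theorem finite_degree_lt (n k : ℕ) : {α : Fin n →₀ ℕ | α.degree < k}.Finite :=
  (Finsupp.finite_of_degree_le k).subset fun _ h => Nat.le_of_lt (by exact h)

/-- The truncation `𝔪 ^ k` as a complex subspace. -/
noncomputable def powSubspace (n k : ℕ) : Submodule ℂ (FormalSeries n) :=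
  (maxIdeal n ^ k).restrictScalars ℂ

theorem mem_powSubspace {n k : ℕ} {g : FormalSeries n} :
    g ∈ powSubspace n k ↔ g ∈ maxIdeal n ^ k := Iff.rfl

instance finiteDimensional_quotient_powSubspace (n k : ℕ) :
    FiniteDimensional ℂ (FormalSeries n ⧸ powSubspace n k) := by
  have := (finite_degree_lt n k).to_subtype
  let c : FormalSeries n →ₗ[ℂ] ({α : Fin n →₀ ℕ | α.degree < k} → ℂ) :=
    LinearMap.pi fun α => MvPowerSeries.coeff α.1
  have hc : powSubspace n k = LinearMap.ker c := by
    ext g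
    rw [mem_powSubspace, mem_maxIdeal_pow_iff, LinearMap.mem_ker, funext_iff]
    simp [c]
  rw [hc]
  exact Module.Finite.equiv (LinearMap.quotKerEquivRange c).symm

theorem sub_trunc_mem {n : ℕ} (k : ℕ) (g : FormalSeries n) :
    g - ∑ α ∈ (finite_degree_lt n k).toFinset,
      MvPowerSeries.coeff α g • MvPowerSeries.monomial α (1 : ℂ) ∈ maxIdeal n ^ k := by
  classical
  rw [mem_maxIdeal_pow_iff]
  intro α hα
  rw [map_sub, map_sum, Finset.sum_eq_single α]
  · simp
  · intro b _ hb
    rw [map_smul, MvPowerSeries.coeff_monomial, if_neg (Ne.symm hb), smul_zero]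
  · intro h
    exact absurd ((finite_degree_lt n k).mem_toFinset.mpr hα) h

theorem monomial_eq_prod {n : ℕ} (α : Fin n →₀ ℕ) :
    (MvPowerSeries.monomial α (1 : ℂ) : FormalSeries n) =
      ∏ i, (MvPowerSeries.X i : FormalSeries n) ^ α i := by
  rw [MvPowerSeries.monomial_one_eq, Finsupp.prod_fintype _ _ (fun i => pow_zero _)]

theorem Derivation.apply_mem_pow_of_mem_pow_succ {A : Type} [CommRing A] [Algebra ℂ A]
    (δ : Derivation ℂ A A) (I : Ideal A) (k : ℕ) : ∀ g ∈ I ^ (k + 1), δ g ∈ I ^ k := by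
  induction k with
  | zero => intro g _; simp
  | succ k ih =>
    intro g hg
    rw [pow_succ] at hg
    induction hg using Submodule.mul_induction_on' with
    | mem_mul_mem a ha b hb =>
      rw [Derivation.leibniz, smul_eq_mul, smul_eq_mul, mul_comm b]
      refine Ideal.add_mem _ (Ideal.mul_mem_right _ _ ha) ?_
      rw [pow_succ]
      exact Ideal.mul_mem_mul (ih a ha) hb
    | add a _ b _ h1 h2 => rw [map_add]; exact Ideal.add_mem _ h1 h2

/-- A derivation loses at most one power of `𝔪`, hence is `𝔪`-adically continuous and determined by
its values on polynomials. -/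
theorem formalDer_ext {n : ℕ} {δ η : FormalDer n}
    (h : ∀ i, δ (MvPowerSeries.X i) = η (MvPowerSeries.X i)) : δ = η := by
  rw [← sub_eq_zero]
  set θ := δ - η with hθ
  have hX : ∀ i, θ (MvPowerSeries.X i) = 0 := fun i => by simp [hθ, h i]
  have hpow : ∀ i (m : ℕ), θ ((MvPowerSeries.X i : FormalSeries n) ^ m) = 0 := by
    intro i m
    rw [Derivation.leibniz_pow, hX]; simp
  have hmon : ∀ α, θ (MvPowerSeries.monomial α (1 : ℂ)) = 0 := by
    intro α
    rw [monomial_eq_prod]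
    refine Finset.prod_induction _ (fun g => θ g = 0) ?_ ?_ ?_
    · intro a b ha hb
      rw [Derivation.leibniz, ha, hb]; simp
    · simp
    · intro i _; exact hpow i _
  ext1 g
  refine eq_zero_of_forall_mem_maxIdeal_pow fun k => ?_
  have := Derivation.apply_mem_pow_of_mem_pow_succ θ _ k _ (sub_trunc_mem (k + 1) g)
  rw [map_sub, map_sum, Finset.sum_eq_zero, sub_zero] at this
  · exact this
  · intro α _
    rw [θ.map_smul, hmon, smul_zero]

/-! ### Filtered operators and formal generalized eigenvectors -/

/-- A complex linear operator on formal power series that respects the `𝔪`-adic filtration. -/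
def IsFiltered {n : ℕ} (T : Module.End ℂ (FormalSeries n)) : Prop :=
  ∀ k, ∀ g ∈ maxIdeal n ^ k, T g ∈ maxIdeal n ^ k

/-- `v` is a formal generalized eigenvector of `T` with eigenvalue `μ`: it is a generalized
eigenvector modulo each power of `𝔪`. -/
def IsFormalGenEigen {n : ℕ} (T : Module.End ℂ (FormalSeries n)) (μ : ℂ)
    (v : FormalSeries n) : Prop :=
  ∀ k, ∃ N, ((T - μ • 1 : Module.End ℂ (FormalSeries n)) ^ N) v ∈ maxIdeal n ^ k

theorem smul_mem_maxIdeal_pow {n k : ℕ} {g : FormalSeries n} (c : ℂ) (hg : g ∈ maxIdeal n ^ k) :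
    c • g ∈ maxIdeal n ^ k := (powSubspace n k).smul_mem c hg

theorem IsFiltered.sub_smul_one {n : ℕ} {T : Module.End ℂ (FormalSeries n)} (hT : IsFiltered T)
    (μ : ℂ) : IsFiltered (T - μ • 1) := by
  intro k g hg
  exact Ideal.sub_mem _ (hT k g hg) (smul_mem_maxIdeal_pow μ hg)

theorem IsFiltered.pow {n : ℕ} {T : Module.End ℂ (FormalSeries n)} (hT : IsFiltered T)
    (N : ℕ) : IsFiltered (T ^ N) := by
  induction N with
  | zero => intro k g hg; simpa using hg
  | succ N ih => intro k g hg; rw [pow_succ']; exact hT k _ (ih k g hg)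

/-- The operator induced by `T` modulo `𝔪 ^ k`. -/
noncomputable def IsFiltered.quot {n : ℕ} {T : Module.End ℂ (FormalSeries n)} (hT : IsFiltered T)
    (k : ℕ) : Module.End ℂ (FormalSeries n ⧸ powSubspace n k) :=
  (powSubspace n k).mapQ (powSubspace n k) T (hT k)

theorem IsFiltered.quot_mk {n : ℕ} {T : Module.End ℂ (FormalSeries n)} (hT : IsFiltered T)
    (k : ℕ) (v : FormalSeries n) :
    hT.quot k ((powSubspace n k).mkQ v) = (powSubspace n k).mkQ (T v) := rfl

theorem IsFiltered.quot_pow_mk {n : ℕ} {T : Module.End ℂ (FormalSeries n)} (hT : IsFiltered T)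
    (k N : ℕ) (v : FormalSeries n) :
    (hT.quot k ^ N) ((powSubspace n k).mkQ v) = (powSubspace n k).mkQ ((T ^ N) v) := by
  induction N with
  | zero => simp
  | succ N ih =>
    rw [pow_succ', pow_succ', Module.End.mul_apply, Module.End.mul_apply, ih, hT.quot_mk]

theorem IsFiltered.quot_sub_smul_one {n : ℕ} {T : Module.End ℂ (FormalSeries n)}
    (hT : IsFiltered T) (k : ℕ) (μ : ℂ) :
    hT.quot k - μ • 1 = (hT.sub_smul_one μ).quot k := by
  refine LinearMap.ext fun x => ?_
  obtain ⟨v, rfl⟩ := (powSubspace n k).mkQ_surjective x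
  rw [quot_mk, LinearMap.sub_apply, quot_mk, LinearMap.sub_apply, map_sub]
  rfl

theorem mkQ_powSubspace_eq_zero_iff {n k : ℕ} (v : FormalSeries n) :
    (powSubspace n k).mkQ v = 0 ↔ v ∈ maxIdeal n ^ k := by
  rw [Submodule.mkQ_apply, Submodule.Quotient.mk_eq_zero, mem_powSubspace]

theorem IsFiltered.mk_mem_maxGenEigenspace_iff {n : ℕ} {T : Module.End ℂ (FormalSeries n)}
    (hT : IsFiltered T) (k : ℕ) (μ : ℂ) (v : FormalSeries n) :
    (powSubspace n k).mkQ v ∈ (hT.quot k).maxGenEigenspace μ ↔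
      ∃ N, ((T - μ • 1 : Module.End ℂ (FormalSeries n)) ^ N) v ∈ maxIdeal n ^ k := by
  rw [Module.End.mem_maxGenEigenspace, hT.quot_sub_smul_one]
  simp_rw [quot_pow_mk, mkQ_powSubspace_eq_zero_iff]

/-- Fitting's lemma on `W`: the ranges of the powers of `S` on `W` stabilize, so after `M` steps `S
^ N v` is also reached from `W` by `S ^ (M + N)`. -/
theorem exists_pow_apply_sub_eq_zero {V : Type*} [AddCommGroup V] [Module ℂ V]
    [FiniteDimensional ℂ V] (S : Module.End ℂ V) (W : Submodule ℂ V) (hW : ∀ w ∈ W, S w ∈ W)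
    (v : V) (N : ℕ) (hv : (S ^ N) v ∈ W) : ∃ u ∈ W, ∃ M, (S ^ M) (v - u) = 0 := by
  let R : Module.End ℂ W := S.restrict hW
  have hR : ∀ (m : ℕ) (w : W), ((R ^ m) w : V) = (S ^ m) w := by
    intro m w
    induction m with
    | zero => simp
    | succ m ih =>
      rw [pow_succ', pow_succ', Module.End.mul_apply, Module.End.mul_apply, ← ih]
      rfl
  obtain ⟨M, hM⟩ := Filter.eventually_atTop.mp R.eventually_iInf_range_pow_eq
  have heq : LinearMap.range (R ^ M) = LinearMap.range (R ^ (M + N)) :=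
    (hM M le_rfl).symm.trans (hM (M + N) (Nat.le_add_right _ _))
  have hmem : (R ^ M) ⟨_, hv⟩ ∈ LinearMap.range (R ^ (M + N)) := heq ▸ ⟨_, rfl⟩
  obtain ⟨u, hu⟩ := hmem
  refine ⟨u, u.2, M + N, ?_⟩
  rw [map_sub, ← hR, hu, hR, pow_add, Module.End.mul_apply, sub_self]

/-- The obstruction to lifting lies in `𝔪 ^ k / 𝔪 ^ (k + 1)`, which is invariant and
finite-dimensional, so a correction by an element of `𝔪 ^ k` removes it. -/
theorem IsFiltered.exists_lift_step {n : ℕ} {S : Module.End ℂ (FormalSeries n)}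
    (hS : IsFiltered S) (k : ℕ) (v : FormalSeries n) (hv : ∃ N, (S ^ N) v ∈ maxIdeal n ^ k) :
    ∃ v', v' - v ∈ maxIdeal n ^ k ∧ ∃ N, (S ^ N) v' ∈ maxIdeal n ^ (k + 1) := by
  obtain ⟨N, hN⟩ := hv
  let W := (powSubspace n k).map (powSubspace n (k + 1)).mkQ
  have hW : ∀ w ∈ W, hS.quot (k + 1) w ∈ W := by
    rintro _ ⟨w, hw, rfl⟩
    exact ⟨S w, hS k w hw, rfl⟩
  obtain ⟨u, hu, M, hM⟩ := exists_pow_apply_sub_eq_zero (hS.quot (k + 1)) W hW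
    ((powSubspace n (k + 1)).mkQ v) N (by rw [hS.quot_pow_mk]; exact ⟨_, hN, rfl⟩)
  obtain ⟨u, hu, rfl⟩ := hu
  rw [← map_sub, hS.quot_pow_mk, mkQ_powSubspace_eq_zero_iff] at hM
  refine ⟨v - u, ?_, M, hM⟩
  rw [sub_sub_cancel_left]
  exact (maxIdeal n ^ k).neg_mem hu

theorem IsFiltered.exists_isFormalGenEigen {n : ℕ} {T : Module.End ℂ (FormalSeries n)}
    (hT : IsFiltered T) (μ : ℂ) (j : ℕ) (v : FormalSeries n)
    (hv : ∃ N, ((T - μ • 1 : Module.End ℂ (FormalSeries n)) ^ N) v ∈ maxIdeal n ^ j) :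
    ∃ v', v' - v ∈ maxIdeal n ^ j ∧ IsFormalGenEigen T μ v' := by
  have hS := hT.sub_smul_one μ
  choose! s hs1 hs2 using fun k => hS.exists_lift_step k
  let a : ℕ → FormalSeries n := fun i => Nat.rec v (fun i w => s (j + i) w) i
  have ha : ∀ i, ∃ N, ((T - μ • 1 : Module.End ℂ (FormalSeries n)) ^ N) (a i) ∈ maxIdeal n ^ (j + i) := by
    intro i
    induction i with
    | zero => exact hv
    | succ i ih => exact hs2 (j + i) (a i) ih
  obtain ⟨g, hg⟩ := exists_limit a j fun i => hs1 (j + i) (a i) (ha i)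
  refine ⟨g, hg 0, fun k => ?_⟩
  obtain ⟨N, hN⟩ := ha k
  refine ⟨N, ?_⟩
  have h1 := Ideal.add_mem _ (hS.pow N _ _ (hg k)) hN
  rw [← map_add, sub_add_cancel] at h1
  exact Ideal.pow_le_pow_right (Nat.le_add_left k j) h1

/-- The operators `T - μ` and `T - ν` on the factors combine to `T - (μ + ν)` on the product by the
Leibniz rule; induction on the total exponent follows. -/
theorem isFormalGenEigen_mul {n : ℕ} {δ : FormalDer n}
    (hδ : IsFiltered (δ : FormalSeries n →ₗ[ℂ] FormalSeries n)) {μ ν : ℂ} {a b : FormalSeries n}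
    (ha : IsFormalGenEigen (δ : FormalSeries n →ₗ[ℂ] FormalSeries n) μ a)
    (hb : IsFormalGenEigen (δ : FormalSeries n →ₗ[ℂ] FormalSeries n) ν b) :
    IsFormalGenEigen (δ : FormalSeries n →ₗ[ℂ] FormalSeries n) (μ + ν) (a * b) := by
  intro k
  obtain ⟨p, hp⟩ := ha k
  obtain ⟨q, hq⟩ := hb k
  set T : Module.End ℂ (FormalSeries n) := (δ : FormalSeries n →ₗ[ℂ] FormalSeries n) with hT
  have key : ∀ (m p q : ℕ), p + q = m → ∀ a b : FormalSeries n,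
      ((T - μ • 1 : Module.End ℂ (FormalSeries n)) ^ p) a ∈ maxIdeal n ^ k → ((T - ν • 1 : Module.End ℂ (FormalSeries n)) ^ q) b ∈ maxIdeal n ^ k →
      ((T - (μ + ν) • 1 : Module.End ℂ (FormalSeries n)) ^ m) (a * b) ∈ maxIdeal n ^ k := by
    intro m
    induction m with
    | zero =>
      intro p q hpq a b ha _
      obtain rfl : p = 0 := by omega
      exact Ideal.mul_mem_right _ _ ha
    | succ m ih =>
      intro p q hpq a b ha hb
      rcases p with _ | p
      · exact (hδ.sub_smul_one _).pow _ _ _ (Ideal.mul_mem_right _ _ ha)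
      rcases q with _ | q
      · exact (hδ.sub_smul_one _).pow _ _ _ (Ideal.mul_mem_left _ _ hb)
      have hsplit : (T - (μ + ν) • 1) (a * b) = (T - μ • 1) a * b + a * (T - ν • 1) b := by
        have : T (a * b) = a * T b + b * T a := δ.leibniz a b
        rw [LinearMap.sub_apply, LinearMap.sub_apply, LinearMap.sub_apply, this]
        simp only [LinearMap.smul_apply, Module.End.one_apply]
        simp only [Algebra.smul_def, map_add]
        ring
      rw [pow_succ, Module.End.mul_apply, hsplit, map_add]
      rw [pow_succ, Module.End.mul_apply] at ha hb
      exact Ideal.add_mem _ (ih p (q + 1) (by omega) _ _ ha (by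
        rwa [pow_succ, Module.End.mul_apply])) (ih (p + 1) q (by omega) _ _ (by
        rwa [pow_succ, Module.End.mul_apply]) hb)
  exact ⟨p + q, key _ p q rfl a b hp hq⟩

theorem isFormalGenEigen_one {n : ℕ} (δ : FormalDer n) :
    IsFormalGenEigen (δ : FormalSeries n →ₗ[ℂ] FormalSeries n) 0 1 := by
  intro k
  refine ⟨1, ?_⟩
  simp

theorem isFormalGenEigen_pow {n : ℕ} {δ : FormalDer n}
    (hδ : IsFiltered (δ : FormalSeries n →ₗ[ℂ] FormalSeries n)) {μ : ℂ} {a : FormalSeries n}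
    (ha : IsFormalGenEigen (δ : FormalSeries n →ₗ[ℂ] FormalSeries n) μ a) (m : ℕ) :
    IsFormalGenEigen (δ : FormalSeries n →ₗ[ℂ] FormalSeries n) (m * μ) (a ^ m) := by
  induction m with
  | zero => simpa using isFormalGenEigen_one δ
  | succ m ih =>
    rw [pow_succ, Nat.cast_succ, add_mul, one_mul]
    exact isFormalGenEigen_mul hδ ih ha

theorem isFormalGenEigen_prod {n : ℕ} {δ : FormalDer n}
    (hδ : IsFiltered (δ : FormalSeries n →ₗ[ℂ] FormalSeries n)) {ι : Type*} (s : Finset ι)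
    (μ : ι → ℂ) (a : ι → FormalSeries n)
    (ha : ∀ i, IsFormalGenEigen (δ : FormalSeries n →ₗ[ℂ] FormalSeries n) (μ i) (a i)) :
    IsFormalGenEigen (δ : FormalSeries n →ₗ[ℂ] FormalSeries n) (∑ i ∈ s, μ i)
      (∏ i ∈ s, a i) := by
  classical
  induction s using Finset.induction_on with
  | empty => simpa using isFormalGenEigen_one δ
  | insert i s hi ih =>
    rw [Finset.sum_insert hi, Finset.prod_insert hi]
    exact isFormalGenEigen_mul hδ (ha i) ih

/-! ### Linear parts and formal coordinate changes -/

/-- The linear part of a formal power series. -/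
noncomputable def linearPart (n : ℕ) : FormalSeries n →ₗ[ℂ] (Fin n → ℂ) :=
  LinearMap.pi fun i => MvPowerSeries.coeff (Finsupp.single i 1)

/-- The linear form with prescribed coefficients. -/
noncomputable def linearForm (n : ℕ) : (Fin n → ℂ) →ₗ[ℂ] FormalSeries n :=
  Fintype.linearCombination ℂ fun i => (MvPowerSeries.X i : FormalSeries n)

theorem linearForm_apply {n : ℕ} (c : Fin n → ℂ) :
    linearForm n c = ∑ i, c i • (MvPowerSeries.X i : FormalSeries n) := rfl

theorem linearPart_X {n : ℕ} (i : Fin n) :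
    linearPart n (MvPowerSeries.X i) = Pi.single i 1 := by
  classical
  ext j
  change MvPowerSeries.coeff (Finsupp.single j 1) (MvPowerSeries.X i : FormalSeries n) = _
  rw [MvPowerSeries.coeff_X, Pi.single_apply]
  simp [Finsupp.single_left_inj]

theorem linearPart_linearForm {n : ℕ} (c : Fin n → ℂ) : linearPart n (linearForm n c) = c := by
  rw [linearForm_apply, map_sum]
  simp_rw [map_smul, linearPart_X]
  ext j
  simp [Pi.single_apply]

theorem linearForm_mem_maxIdeal {n : ℕ} (c : Fin n → ℂ) : linearForm n c ∈ maxIdeal n := by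
  rw [linearForm_apply]
  exact Ideal.sum_mem _ fun i _ => by
    rw [Algebra.smul_def]; exact Ideal.mul_mem_left _ _ (X_mem_maxIdeal i)

theorem linearPart_eq_zero_iff {n : ℕ} {g : FormalSeries n} (hg : g ∈ maxIdeal n) :
    linearPart n g = 0 ↔ g ∈ maxIdeal n ^ 2 := by
  rw [mem_maxIdeal_pow_iff]
  constructor
  · intro h α hα
    rcases Nat.lt_or_ge α.degree 1 with h0 | h1
    · rw [Nat.lt_one_iff, Finsupp.degree_eq_zero_iff] at h0
      rw [h0]
      simpa using (mem_maxIdeal_iff g).mp hg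
    · obtain ⟨i, rfl⟩ : α ∈ Set.range (fun i : Fin n => Finsupp.single i 1) := by
        rw [Finsupp.range_single_one]
        exact le_antisymm (by omega) h1
      exact congrFun h i
  · intro h
    ext i
    exact h _ (by simp)

theorem sub_linearForm_linearPart_mem {n : ℕ} {g : FormalSeries n} (hg : g ∈ maxIdeal n) :
    g - linearForm n (linearPart n g) ∈ maxIdeal n ^ 2 := by
  rw [← linearPart_eq_zero_iff (Ideal.sub_mem _ hg (linearForm_mem_maxIdeal _)), map_sub,
    linearPart_linearForm, sub_self]

theorem AlgHom.map_maxIdeal_pow {n : ℕ} (φ : FormalSeries n →ₐ[ℂ] FormalSeries n)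
    (h : ∀ i, φ (MvPowerSeries.X i) ∈ maxIdeal n) (k : ℕ) {g : FormalSeries n}
    (hg : g ∈ maxIdeal n ^ k) : φ g ∈ maxIdeal n ^ k := by
  have h1 : (maxIdeal n).map (φ : FormalSeries n →+* FormalSeries n) ≤ maxIdeal n := by
    rw [maxIdeal, Ideal.map_span, Ideal.span_le]
    rintro _ ⟨_, ⟨i, rfl⟩, rfl⟩
    exact h i
  have := Ideal.mem_map_of_mem (φ : FormalSeries n →+* FormalSeries n) hg
  rw [Ideal.map_pow] at this
  exact Ideal.pow_right_mono h1 k this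

/-- Surjectivity on `𝔪 / 𝔪 ^ 2` propagates to `𝔪 ^ k / 𝔪 ^ (k + 1)`, which is spanned by products of
classes from `𝔪 / 𝔪 ^ 2`. -/
theorem AlgHom.exists_sub_apply_mem {n : ℕ} (φ : FormalSeries n →ₐ[ℂ] FormalSeries n)
    (h : ∀ i, φ (MvPowerSeries.X i) ∈ maxIdeal n)
    (hspan : Submodule.span ℂ (Set.range fun i => linearPart n (φ (MvPowerSeries.X i))) = ⊤)
    (k : ℕ) : ∀ g ∈ maxIdeal n ^ k,
      ∃ q ∈ maxIdeal n ^ k, g - φ q ∈ maxIdeal n ^ (k + 1) := by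
  have hone : ∀ g ∈ maxIdeal n, ∃ q ∈ maxIdeal n, g - φ q ∈ maxIdeal n ^ 2 := by
    intro g hg
    have : linearPart n g ∈
        Submodule.span ℂ (Set.range fun i => linearPart n (φ (MvPowerSeries.X i))) := by
      rw [hspan]; trivial
    obtain ⟨c, hc⟩ := (Submodule.mem_span_range_iff_exists_fun ℂ).mp this
    have hq := linearForm_mem_maxIdeal c
    refine ⟨linearForm n c, hq, ?_⟩
    have hφ : φ (linearForm n c) ∈ maxIdeal n := by
      have := AlgHom.map_maxIdeal_pow φ h 1 (g := linearForm n c) (by simpa using hq)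
      simpa using this
    rw [← linearPart_eq_zero_iff (Ideal.sub_mem _ hg hφ), map_sub, ← hc, linearForm_apply, map_sum,
      map_sum]
    simp_rw [map_smul, sub_self]
  induction k with
  | zero =>
    intro g _
    refine ⟨algebraMap ℂ _ (MvPowerSeries.constantCoeff g), by simp, ?_⟩
    rw [AlgHom.commutes, zero_add, pow_one]
    exact sub_constantCoeff_mem_maxIdeal g
  | succ k ih =>
    intro g hg
    rw [pow_succ] at hg
    induction hg using Submodule.mul_induction_on' with
    | mem_mul_mem a ha b hb =>
      obtain ⟨p, hp, hp'⟩ := ih a ha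
      obtain ⟨q, hq, hq'⟩ := hone b hb
      refine ⟨p * q, by rw [pow_succ]; exact Ideal.mul_mem_mul hp hq, ?_⟩
      have e : a * b - φ (p * q) = (a - φ p) * b + φ p * (b - φ q) := by rw [map_mul]; ring
      rw [e]
      refine Ideal.add_mem _ (by rw [pow_succ]; exact Ideal.mul_mem_mul hp' hb) ?_
      have := Ideal.mul_mem_mul (AlgHom.map_maxIdeal_pow φ h k hp) hq'
      rwa [← pow_add] at this
    | add a _ b _ h1 h2 =>
      obtain ⟨p, hp, hp'⟩ := h1
      obtain ⟨q, hq, hq'⟩ := h2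
      refine ⟨p + q, Ideal.add_mem _ hp hq, ?_⟩
      rw [map_add, add_sub_add_comm]
      exact Ideal.add_mem _ hp' hq'

/-- The formal inverse function theorem. -/
theorem AlgHom.bijective_of_span_linearPart {n : ℕ} (φ : FormalSeries n →ₐ[ℂ] FormalSeries n)
    (h : ∀ i, φ (MvPowerSeries.X i) ∈ maxIdeal n)
    (hspan : Submodule.span ℂ (Set.range fun i => linearPart n (φ (MvPowerSeries.X i))) = ⊤) :
    Function.Bijective φ := by
  have hsurj : Function.Surjective φ := by
    intro g
    choose! s hs1 hs2 using AlgHom.exists_sub_apply_mem φ h hspan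
    let a : ℕ → FormalSeries n := fun i => Nat.rec 0 (fun i w => w + s i (g - φ w)) i
    have ha : ∀ i, g - φ (a i) ∈ maxIdeal n ^ i := by
      intro i
      induction i with
      | zero => simp
      | succ i ih =>
        change g - φ (a i + s i (g - φ (a i))) ∈ _
        rw [map_add, ← sub_sub]
        exact hs2 i _ ih
    obtain ⟨q, hq⟩ := exists_limit a 0 fun i => by
      change a i + s i (g - φ (a i)) - a i ∈ _
      rw [add_sub_cancel_left, zero_add]
      exact hs1 i _ (ha i)
    refine ⟨q, (sub_eq_zero.mp (eq_zero_of_forall_mem_maxIdeal_pow fun k => ?_)).symm⟩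
    have h1 := AlgHom.map_maxIdeal_pow φ h k (by simpa using hq k)
    rw [map_sub] at h1
    have := Ideal.sub_mem _ (ha k) h1
    rwa [sub_sub_sub_cancel_right] at this
  refine ⟨?_, hsurj⟩
  have hfil : IsFiltered (φ.toLinearMap) := fun k g hg => AlgHom.map_maxIdeal_pow φ h k hg
  rw [injective_iff_map_eq_zero]
  intro g hg
  refine eq_zero_of_forall_mem_maxIdeal_pow fun k => ?_
  -- On the finite-dimensional quotient by `𝔪 ^ k`, surjectivity forces injectivity, so the kernel
  -- lies in every power of `𝔪`.
  have hs : Function.Surjective (hfil.quot k) := by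
    intro x
    obtain ⟨v, rfl⟩ := (powSubspace n k).mkQ_surjective x
    obtain ⟨u, rfl⟩ := hsurj v
    exact ⟨(powSubspace n k).mkQ u, rfl⟩
  have hi := LinearMap.injective_iff_surjective.mpr hs
  rw [← mkQ_powSubspace_eq_zero_iff]
  apply hi
  rw [map_zero, hfil.quot_mk]
  change (powSubspace n k).mkQ (φ g) = 0
  rw [hg, map_zero]

theorem exists_algEquiv_apply_X_eq {n : ℕ} (y : Fin n → FormalSeries n)
    (hy : ∀ i, y i ∈ maxIdeal n)
    (hspan : Submodule.span ℂ (Set.range fun i => linearPart n (y i)) = ⊤) :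
    ∃ ψ : FormalSeries n ≃ₐ[ℂ] FormalSeries n, ∀ i, ψ (MvPowerSeries.X i) = y i := by
  have hs : MvPowerSeries.HasSubst y :=
    MvPowerSeries.hasSubst_of_constantCoeff_zero fun i => (mem_maxIdeal_iff _).mp (hy i)
  have hX : ∀ i, MvPowerSeries.substAlgHom (R := ℂ) hs (MvPowerSeries.X i) = y i :=
    MvPowerSeries.substAlgHom_X hs
  refine ⟨AlgEquiv.ofBijective (MvPowerSeries.substAlgHom hs)
    (AlgHom.bijective_of_span_linearPart _ ?_ ?_), hX⟩
  · intro i; rw [hX]; exact hy i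
  · simp_rw [hX]; exact hspan

theorem AlgEquiv.mem_maxIdeal {n : ℕ} (ψ : FormalSeries n ≃ₐ[ℂ] FormalSeries n)
    {g : FormalSeries n} (hg : g ∈ maxIdeal n) : ψ g ∈ maxIdeal n := by
  rw [mem_maxIdeal_iff_not_isUnit] at hg ⊢
  rwa [isUnit_map_iff]

theorem AlgEquiv.mem_maxIdeal_pow_iff {n : ℕ} (ψ : FormalSeries n ≃ₐ[ℂ] FormalSeries n) (k : ℕ)
    (g : FormalSeries n) : ψ g ∈ maxIdeal n ^ k ↔ g ∈ maxIdeal n ^ k := by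
  have key : ∀ (φ : FormalSeries n ≃ₐ[ℂ] FormalSeries n) (g : FormalSeries n),
      g ∈ maxIdeal n ^ k → φ g ∈ maxIdeal n ^ k := fun φ g hg =>
    AlgHom.map_maxIdeal_pow (φ : FormalSeries n →ₐ[ℂ] FormalSeries n)
      (fun i => AlgEquiv.mem_maxIdeal φ (X_mem_maxIdeal i)) k hg
  refine ⟨fun h => ?_, key ψ g⟩
  simpa using key ψ.symm _ h

/-! ### Formal Jordan decomposition of a logarithmic vector field -/

theorem exists_span_genEigenvectors {n : ℕ} (A : Module.End ℂ (Fin n → ℂ)) :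
    ∃ (b : Fin n → Fin n → ℂ) (w : Fin n → ℂ), Submodule.span ℂ (Set.range b) = ⊤ ∧
      ∀ i, b i ∈ A.maxGenEigenspace (w i) := by
  obtain ⟨S, hS, hspan, hli⟩ :=
    exists_linearIndependent ℂ (⋃ μ, (A.maxGenEigenspace μ : Set (Fin n → ℂ)))
  have htop : Submodule.span ℂ S = ⊤ := by
    rw [hspan, Submodule.span_iUnion]
    simpa using A.iSup_maxGenEigenspace_eq_top
  let B := Module.Basis.mk hli (by rw [Subtype.range_coe, htop])
  have : Fintype S := FiniteDimensional.fintypeBasisIndex B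
  have hcard : Fintype.card S = n := by
    rw [← Module.finrank_eq_card_basis B, Module.finrank_fin_fun]
  let e : Fin n ≃ S := (Fintype.equivFinOfCardEq hcard).symm
  have hmem : ∀ i : S, ∃ μ, (i : Fin n → ℂ) ∈ A.maxGenEigenspace μ := fun i => by
    simpa using hS i.2
  choose μ hμ using hmem
  refine ⟨fun i => e i, fun i => μ (e i), ?_, fun i => hμ _⟩
  have : Set.range (fun i => (e i : Fin n → ℂ)) = S := by
    exact (e.surjective.range_comp (fun x : S => (x : Fin n → ℂ))).trans Subtype.range_coe
  rw [this, htop]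

theorem isFiltered_of_mem_smul_top {n : ℕ} {δ : FormalDer n}
    (hδ : δ ∈ maxIdeal n • (⊤ : Submodule (FormalSeries n) (FormalDer n))) :
    IsFiltered (δ : FormalSeries n →ₗ[ℂ] FormalSeries n) :=
  fun k => apply_mem_pow_of_mem_smul_top hδ k

/-- Formal coordinates that are generalized eigenvectors of a singular vector field. -/
theorem exists_genEigen_coordinates {n : ℕ} {δ : FormalDer n}
    (hδ : δ ∈ maxIdeal n • (⊤ : Submodule (FormalSeries n) (FormalDer n))) :
    ∃ (ψ : FormalSeries n ≃ₐ[ℂ] FormalSeries n) (w : Fin n → ℂ),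
      ∀ i, IsFormalGenEigen (δ : FormalSeries n →ₗ[ℂ] FormalSeries n) (w i)
        (ψ (MvPowerSeries.X i)) := by
  have hT := isFiltered_of_mem_smul_top hδ
  set T : Module.End ℂ (FormalSeries n) := (δ : FormalSeries n →ₗ[ℂ] FormalSeries n)
  -- `A` is the operator induced by `δ` on `𝔪 / 𝔪 ^ 2`; its generalized eigenvectors are lifted
  -- below to formal coordinates.
  let A : Module.End ℂ (Fin n → ℂ) := linearPart n ∘ₗ T ∘ₗ linearForm n
  have hA : ∀ g ∈ maxIdeal n, linearPart n (T g) = A (linearPart n g) := by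
    intro g hg
    have h1 := hT 2 _ (sub_linearForm_linearPart_mem hg)
    have h2 := (linearPart_eq_zero_iff (Ideal.pow_le_self two_ne_zero h1)).mpr h1
    rw [map_sub, map_sub, sub_eq_zero] at h2
    exact h2
  obtain ⟨b, w, hb, hw⟩ := exists_span_genEigenvectors A
  have hpow : ∀ (μ : ℂ) (N : ℕ), ∀ g ∈ maxIdeal n,
      linearPart n (((T - μ • 1 : Module.End ℂ (FormalSeries n)) ^ N) g) =
        ((A - μ • 1 : Module.End ℂ (Fin n → ℂ)) ^ N) (linearPart n g) := by
    intro μ N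
    induction N with
    | zero => intro g _; simp
    | succ N ih =>
      intro g hg
      have hg' := (hT.sub_smul_one μ) 1 g (by simpa using hg)
      rw [pow_one] at hg'
      rw [pow_succ, Module.End.mul_apply, ih _ hg', pow_succ, Module.End.mul_apply]
      congr 1
      rw [LinearMap.sub_apply, map_sub, hA g hg, LinearMap.sub_apply]
      congr 1
  have hlift : ∀ i, ∃ y, y - linearForm n (b i) ∈ maxIdeal n ^ 2 ∧
      IsFormalGenEigen T (w i) y := by
    intro i
    refine hT.exists_isFormalGenEigen (w i) 2 _ ?_
    obtain ⟨N, hN⟩ := (Module.End.mem_maxGenEigenspace _ _ _).mp (hw i)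
    have hm := linearForm_mem_maxIdeal (b i)
    refine ⟨N, ?_⟩
    rw [← linearPart_eq_zero_iff, hpow _ _ _ hm, linearPart_linearForm, hN]
    have := ((hT.sub_smul_one (w i)).pow N) 1 (linearForm n (b i)) (by simpa using hm)
    simpa using this
  choose y hy1 hy2 using hlift
  have hym : ∀ i, y i ∈ maxIdeal n := fun i => by
    have := Ideal.add_mem _ (Ideal.pow_le_self two_ne_zero (hy1 i)) (linearForm_mem_maxIdeal (b i))
    rwa [sub_add_cancel] at this
  have hlin : ∀ i, linearPart n (y i) = b i := fun i => by
    have := (linearPart_eq_zero_iff (Ideal.pow_le_self two_ne_zero (hy1 i))).mpr (hy1 i)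
    rwa [map_sub, linearPart_linearForm, sub_eq_zero] at this
  obtain ⟨ψ, hψ⟩ := exists_algEquiv_apply_X_eq y hym (by simp_rw [hlin]; exact hb)
  exact ⟨ψ, w, fun i => by rw [hψ]; exact hy2 i⟩

/-- A singular logarithmic vector field has an equation of the divisor as formal generalized
eigenvector. -/
theorem exists_unit_mul_isFormalGenEigen {n : ℕ} {δ : FormalDer n}
    (hδ : δ ∈ maxIdeal n • (⊤ : Submodule (FormalSeries n) (FormalDer n)))
    {f : FormalSeries n} (hf : δ ∈ logDer f) :
    ∃ (u : (FormalSeries n)ˣ) (c : ℂ),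
      IsFormalGenEigen (δ : FormalSeries n →ₗ[ℂ] FormalSeries n) c (u * f) := by
  obtain ⟨a, ha⟩ := Ideal.mem_span_singleton'.mp (hf f (Ideal.mem_span_singleton_self f))
  let D : Module.End ℂ (FormalSeries n) := (δ : FormalSeries n →ₗ[ℂ] FormalSeries n)
  have hD : IsFiltered D := isFiltered_of_mem_smul_top hδ
  -- Since `D f = a f`, one has `D (g f) = (T g) f`. As `1` is an eigenvector of `T` modulo `𝔪` with
  -- eigenvalue `a(0)`, it lifts to a unit `h`.
  let T : Module.End ℂ (FormalSeries n) := D + LinearMap.mulLeft ℂ a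
  have hT : IsFiltered T := fun k g hg => Ideal.add_mem _ (hD k g hg) (Ideal.mul_mem_left _ a hg)
  set c := MvPowerSeries.constantCoeff a
  obtain ⟨h, h1, h2⟩ := hT.exists_isFormalGenEigen c 1 1 ⟨1, by
    have : T 1 = a := by
      change δ 1 + a * 1 = a
      rw [Derivation.map_one_eq_zero, zero_add, mul_one]
    rw [pow_one, pow_one, LinearMap.sub_apply, this, LinearMap.smul_apply, Module.End.one_apply,
      ← Algebra.algebraMap_eq_smul_one]
    exact sub_constantCoeff_mem_maxIdeal a⟩
  have hu : IsUnit h := by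
    by_contra hh
    rw [← mem_maxIdeal_iff_not_isUnit] at hh
    rw [pow_one] at h1
    have := Ideal.sub_mem _ hh h1
    rw [sub_sub_cancel, mem_maxIdeal_iff_not_isUnit] at this
    exact this isUnit_one
  refine ⟨hu.unit, c, fun k => ?_⟩
  obtain ⟨N, hN⟩ := h2 k
  refine ⟨N, ?_⟩
  have key : ∀ (N : ℕ) (g : FormalSeries n),
      ((D - c • 1 : Module.End ℂ (FormalSeries n)) ^ N) (g * f) =
        ((T - c • 1 : Module.End ℂ (FormalSeries n)) ^ N) g * f := by
    intro N
    induction N with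
    | zero => intro g; simp
    | succ N ih =>
      intro g
      rw [pow_succ, pow_succ, Module.End.mul_apply, Module.End.mul_apply, ← ih]
      congr 1
      have h3 : D (g * f) = g * D f + f * D g := δ.leibniz g f
      have h4 : D f = a * f := ha.symm
      have h5 : T g = D g + a * g := rfl
      rw [LinearMap.sub_apply, LinearMap.sub_apply, h3, h4, h5]
      simp only [LinearMap.smul_apply, Module.End.one_apply]
      simp only [Algebra.smul_def]
      ring
  change ((D - c • 1 : Module.End ℂ (FormalSeries n)) ^ N) (h * f) ∈ _
  rw [key]
  exact Ideal.mul_mem_right _ _ hN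

theorem isFormalGenEigen_monomial {n : ℕ} {δ : FormalDer n}
    (hδ : IsFiltered (δ : FormalSeries n →ₗ[ℂ] FormalSeries n))
    (ψ : FormalSeries n ≃ₐ[ℂ] FormalSeries n) (w : Fin n → ℂ)
    (hw : ∀ i, IsFormalGenEigen (δ : FormalSeries n →ₗ[ℂ] FormalSeries n) (w i)
      (ψ (MvPowerSeries.X i))) (α : Fin n →₀ ℕ) :
    IsFormalGenEigen (δ : FormalSeries n →ₗ[ℂ] FormalSeries n) (∑ i, α i * w i)
      (ψ (MvPowerSeries.monomial α (1 : ℂ))) := by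
  rw [monomial_eq_prod, map_prod]
  simp_rw [map_pow]
  exact isFormalGenEigen_prod hδ _ _ _ fun i => isFormalGenEigen_pow hδ (hw i) _

/-- A formal generalized eigenvector involves, in generalized eigencoordinates, only monomials
of weight equal to its eigenvalue. -/
theorem IsFormalGenEigen.coeff_eq_zero {n : ℕ} {δ : FormalDer n}
    (hδ : IsFiltered (δ : FormalSeries n →ₗ[ℂ] FormalSeries n))
    (ψ : FormalSeries n ≃ₐ[ℂ] FormalSeries n) (w : Fin n → ℂ)
    (hw : ∀ i, IsFormalGenEigen (δ : FormalSeries n →ₗ[ℂ] FormalSeries n) (w i)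
      (ψ (MvPowerSeries.X i))) {c : ℂ} {g : FormalSeries n}
    (hg : IsFormalGenEigen (δ : FormalSeries n →ₗ[ℂ] FormalSeries n) c (ψ g))
    (α : Fin n →₀ ℕ) (hα : ∑ i, α i * w i ≠ c) : MvPowerSeries.coeff α g = 0 := by
  classical
  set k := α.degree + 1
  let s := (finite_degree_lt n k).toFinset
  let t : (Fin n →₀ ℕ) → FormalSeries n := fun β =>
    MvPowerSeries.coeff β g • MvPowerSeries.monomial β (1 : ℂ)
  let E := (hδ.quot k).maxGenEigenspace
  let π : FormalSeries n →ₗ[ℂ] FormalSeries n ⧸ powSubspace n k := (powSubspace n k).mkQ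
  have ht : ∀ β, π (ψ (t β)) ∈ E (∑ i, β i * w i) := by
    intro β
    have := (hδ.mk_mem_maxGenEigenspace_iff k _ _).mpr (isFormalGenEigen_monomial hδ ψ w hw β k)
    simp only [t, map_smul]
    exact (E (∑ i, β i * w i)).smul_mem _ this
  have hgE : π (ψ g) ∈ E c := (hδ.mk_mem_maxGenEigenspace_iff k _ _).mpr (hg k)
  have hsum : π (ψ g) = ∑ β ∈ s, π (ψ (t β)) := by
    have := (AlgEquiv.mem_maxIdeal_pow_iff ψ k _).mpr (sub_trunc_mem k g)
    rw [← mkQ_powSubspace_eq_zero_iff, map_sub, map_sub, sub_eq_zero] at this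
    rw [← map_sum, ← map_sum]
    exact this
  -- The terms of weight other than `c` sum to an element of `E c` that also lies in the span of the
  -- other generalized eigenspaces.
  have hzero : π (ψ (∑ β ∈ s with ∑ i, β i * w i ≠ c, t β)) = 0 := by
    have hdis := (hδ.quot k).independent_maxGenEigenspace c
    refine Submodule.disjoint_def.mp hdis _ ?_ ?_
    · have hsplit := Finset.sum_filter_add_sum_filter_not s
        (fun β : Fin n →₀ ℕ => ∑ i, β i * w i = c) fun β => π (ψ (t β))
      rw [← hsum] at hsplit
      rw [map_sum, map_sum, eq_sub_iff_add_eq'.mpr hsplit]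
      refine Submodule.sub_mem _ hgE (Submodule.sum_mem _ fun β hβ => ?_)
      rw [← (Finset.mem_filter.mp hβ).2]
      exact ht β
    · rw [map_sum, map_sum]
      refine Submodule.sum_mem _ fun β hβ => ?_
      exact Submodule.mem_iSup_of_mem (∑ i, β i * w i)
        (Submodule.mem_iSup_of_mem (Finset.mem_filter.mp hβ).2 (ht β))
  have h1 := (AlgEquiv.mem_maxIdeal_pow_iff ψ k _).mp ((mkQ_powSubspace_eq_zero_iff _).mp hzero)
  have h2 := (mem_maxIdeal_pow_iff _ _).mp h1 α (Nat.lt_succ_self _)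
  rw [map_sum, Finset.sum_eq_single α] at h2
  · simpa [t] using h2
  · intro β _ hβ
    simp only [t]
    rw [map_smul, MvPowerSeries.coeff_monomial, if_neg (Ne.symm hβ), smul_zero]
  · intro h
    exact absurd (Finset.mem_filter.mpr
      ⟨(finite_degree_lt n k).mem_toFinset.mpr (Nat.lt_succ_self _), hα⟩) h

/-! ### Diagonal vector fields as semisimple parts -/

/-- The diagonal vector field `∑ wᵢ xᵢ ∂ᵢ`. -/
noncomputable def diagDer {n : ℕ} (w : Fin n → ℂ) : FormalDer n :=
  ∑ i, (w i • (MvPowerSeries.X i : FormalSeries n)) • MvPowerSeries.pderiv ℂ i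

theorem diagDer_apply {n : ℕ} (w : Fin n → ℂ) (g : FormalSeries n) :
    diagDer w g = ∑ i, w i • (MvPowerSeries.X i * MvPowerSeries.pderiv ℂ i g) := by
  have h := map_sum (Derivation.coeFnAddMonoidHom (R := ℂ) (A := FormalSeries n)
    (M := FormalSeries n)) (fun i : Fin n =>
    (w i • (MvPowerSeries.X i : FormalSeries n)) • MvPowerSeries.pderiv ℂ i) Finset.univ
  have h' := congrFun h g
  rw [Finset.sum_apply] at h'
  refine h'.trans (Finset.sum_congr rfl fun i _ => ?_)
  change (w i • (MvPowerSeries.X i : FormalSeries n)) • MvPowerSeries.pderiv ℂ i g = _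
  rw [smul_eq_mul, smul_mul_assoc]

theorem coeff_X_mul_pderiv {n : ℕ} (i : Fin n) (g : FormalSeries n) (α : Fin n →₀ ℕ) :
    MvPowerSeries.coeff α (MvPowerSeries.X i * MvPowerSeries.pderiv ℂ i g) =
      α i * MvPowerSeries.coeff α g := by
  classical
  rw [MvPowerSeries.X_def, MvPowerSeries.coeff_monomial_mul]
  split_ifs with h
  · have h1 : 1 ≤ α i := Finsupp.single_le_iff.mp h
    rw [one_mul, MvPowerSeries.coeff_pderiv, tsub_add_cancel_of_le h, Finsupp.tsub_apply,
      Finsupp.single_eq_same, mul_comm, Nat.cast_sub h1]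
    simp
  · have h1 : α i = 0 := by
      by_contra h0
      exact h (Finsupp.single_le_iff.mpr (Nat.one_le_iff_ne_zero.mpr h0))
    rw [h1]; simp

theorem coeff_diagDer {n : ℕ} (w : Fin n → ℂ) (g : FormalSeries n) (α : Fin n →₀ ℕ) :
    MvPowerSeries.coeff α (diagDer w g) = (∑ i, α i * w i) * MvPowerSeries.coeff α g := by
  rw [diagDer_apply, map_sum, Finset.sum_mul]
  refine Finset.sum_congr rfl fun i _ => ?_
  rw [map_smul, coeff_X_mul_pderiv, smul_eq_mul]
  ring

theorem diagDer_X {n : ℕ} (w : Fin n → ℂ) (i : Fin n) :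
    diagDer w (MvPowerSeries.X i) = w i • (MvPowerSeries.X i : FormalSeries n) := by
  classical
  ext α
  rw [coeff_diagDer, map_smul, smul_eq_mul, MvPowerSeries.coeff_X]
  split_ifs with h
  · rw [h]
    simp [Finsupp.single_apply, Finset.sum_ite_eq]
  · simp

theorem diagDer_mem_diagFields {n : ℕ} {w : Fin n → ℂ} {g : FormalSeries n} {c : ℂ}
    (h : diagDer w g = c • g) : diagDer w ∈ diagFields g := by
  refine ⟨?_, ⟨w, diagDer_X w⟩, c, h⟩
  intro q hq
  obtain ⟨a, rfl⟩ := Ideal.mem_span_singleton'.mp hq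
  rw [Derivation.leibniz, h, smul_eq_mul, smul_eq_mul, Algebra.smul_def]
  refine Ideal.add_mem _ (Ideal.mul_mem_left _ _ (Ideal.mul_mem_left _ _ ?_))
    (Ideal.mul_mem_right _ _ ?_) <;> exact Ideal.mem_span_singleton_self g

attribute [local instance] LieRing.ofAssociativeRing

/-- `diagDer w` plays the role of the semisimple part of `δ` in the eigencoordinates. If `w ≠ 0`, it
is a nonzero diagonal field scaling an equation equivalent to `f`; if `w = 0`, all monomials have
weight zero and `δ` is nilpotent on jets. -/
theorem exists_diagFields_ne_bot_or_isNilpotent {n : ℕ} {f : FormalSeries n} {δ : FormalDer n}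
    (hf : δ ∈ logDer f)
    (hδ : δ ∈ maxIdeal n • (⊤ : Submodule (FormalSeries n) (FormalDer n))) :
    (∃ g, ContactEquiv f g ∧ diagFields g ≠ ⊥) ∨
      ∀ k, IsNilpotent ((isFiltered_of_mem_smul_top hδ).quot k) := by
  obtain ⟨ψ, w, hw⟩ := exists_genEigen_coordinates hδ
  have hT := isFiltered_of_mem_smul_top hδ
  by_cases hw0 : w = 0
  · right
    intro k
    rw [Module.End.isNilpotent_iff_of_finite]
    intro x
    obtain ⟨v, rfl⟩ := (powSubspace n k).mkQ_surjective x
    suffices h : (powSubspace n k).mkQ v ∈ (hT.quot k).maxGenEigenspace 0 by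
      simpa [Module.End.mem_maxGenEigenspace] using h
    obtain ⟨g, rfl⟩ := ψ.surjective v
    have h1 := (AlgEquiv.mem_maxIdeal_pow_iff ψ k _).mpr (sub_trunc_mem k g)
    rw [← mkQ_powSubspace_eq_zero_iff, map_sub, map_sub, sub_eq_zero] at h1
    rw [h1, map_sum, map_sum]
    refine Submodule.sum_mem _ fun α _ => ?_
    rw [map_smul, map_smul]
    refine Submodule.smul_mem _ _ ?_
    have := isFormalGenEigen_monomial hT ψ w hw α k
    rw [hw0] at this
    simp only [Pi.zero_apply, mul_zero, Finset.sum_const_zero] at this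
    exact (hT.mk_mem_maxGenEigenspace_iff k _ _).mpr this
  · left
    obtain ⟨u, c, hu⟩ := exists_unit_mul_isFormalGenEigen hδ hf
    refine ⟨ψ.symm (u * f), ⟨ψ.symm, Units.map (ψ.symm : FormalSeries n →* FormalSeries n) u,
      map_mul _ _ _⟩, fun hbot => hw0 ?_⟩
    have hmem : diagDer w ∈ diagFields (ψ.symm (u * f)) := by
      refine diagDer_mem_diagFields (c := c) ?_
      ext α
      rw [coeff_diagDer, map_smul, smul_eq_mul]
      by_cases h : ∑ i, α i * w i = c
      · rw [h]
      · rw [IsFormalGenEigen.coeff_eq_zero hT ψ w hw (c := c) (by simpa using hu) α h, mul_zero,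
          mul_zero]
    rw [hbot, Submodule.mem_bot] at hmem
    ext i
    have h1 := diagDer_X w i
    rw [hmem] at h1
    have h2 := congrArg (MvPowerSeries.coeff (Finsupp.single i 1)) h1
    rw [map_smul] at h2
    simpa using h2.symm

/-! ### No diagonal fields: Engel and Artin–Rees -/

/-- The action of the logarithmic vector fields on the formal power series modulo `𝔪 ^ k`. -/
noncomputable def jetRep {n : ℕ} {f : FormalSeries n}
    (hf : logDer f ≤ maxIdeal n • (⊤ : Submodule (FormalSeries n) (FormalDer n))) (k : ℕ) :
    logDerLie f →ₗ⁅ℂ⁆ Module.End ℂ (FormalSeries n ⧸ powSubspace n k) where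
  toFun δ := (isFiltered_of_mem_smul_top (hf δ.2)).quot k
  map_add' δ η := by
    refine LinearMap.ext fun x => ?_
    obtain ⟨v, rfl⟩ := (powSubspace n k).mkQ_surjective x
    rfl
  map_smul' c δ := by
    refine LinearMap.ext fun x => ?_
    obtain ⟨v, rfl⟩ := (powSubspace n k).mkQ_surjective x
    rfl
  map_lie' := by
    intro δ η
    refine LinearMap.ext fun x => ?_
    obtain ⟨v, rfl⟩ := (powSubspace n k).mkQ_surjective x
    rw [Ring.lie_def]
    simp only [LinearMap.sub_apply, Module.End.mul_apply, IsFiltered.quot_mk, ← map_sub]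
    rfl

theorem jetRep_eq_zero_iff {n : ℕ} {f : FormalSeries n}
    (hf : logDer f ≤ maxIdeal n • (⊤ : Submodule (FormalSeries n) (FormalDer n))) (k : ℕ)
    (δ : logDerLie f) : jetRep hf k δ = 0 ↔ ∀ g, (δ : FormalDer n) g ∈ maxIdeal n ^ k := by
  constructor
  · intro h g
    have := LinearMap.congr_fun h ((powSubspace n k).mkQ g)
    exact (mkQ_powSubspace_eq_zero_iff _).mp this
  · intro h
    refine LinearMap.ext fun x => ?_
    obtain ⟨v, rfl⟩ := (powSubspace n k).mkQ_surjective x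
    exact (mkQ_powSubspace_eq_zero_iff _).mpr (h v)

/-- Engel's theorem: nilpotent endomorphisms are ad-nilpotent, so the image of `ρ` is nilpotent,
hence solvable. -/
theorem LieHom.exists_derivedSeries_le_ker_of_isNilpotent {L V : Type*} [LieRing L]
    [LieAlgebra ℂ L] [AddCommGroup V] [Module ℂ V] [FiniteDimensional ℂ V]
    (ρ : L →ₗ⁅ℂ⁆ Module.End ℂ V) (h : ∀ x, IsNilpotent (ρ x)) :
    ∃ k, LieAlgebra.derivedSeries ℂ L k ≤ ρ.ker := by
  have hnil : LieRing.IsNilpotent ρ.range := by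
    rw [LieAlgebra.isNilpotent_iff_forall (R := ℂ)]
    rintro ⟨_, x, rfl⟩
    exact LieAlgebra.isNilpotent_ad_of_isNilpotent (h x)
  have hsol : LieAlgebra.IsSolvable ρ.range := inferInstance
  obtain ⟨k, hk⟩ := LieAlgebra.IsSolvable.solvable ℂ ρ.range
  refine ⟨k, ?_⟩
  have h1 := LieIdeal.derivedSeries_map_le (f := ρ.rangeRestrict) k
  rw [hk, le_bot_iff, LieIdeal.map_eq_bot_iff] at h1
  intro x hx
  have h2 := h1 hx
  rw [LieHom.mem_ker] at h2 ⊢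
  exact congrArg Subtype.val h2

theorem LieAlgebra.isSolvable_quotient_iff {L : Type*} [LieRing L] [LieAlgebra ℂ L]
    (I : LieIdeal ℂ L) :
    LieAlgebra.IsSolvable (L ⧸ I) ↔ ∃ k, LieAlgebra.derivedSeries ℂ L k ≤ I := by
  rw [LieAlgebra.isSolvable_iff ℂ]
  let q : L →ₗ⁅ℂ⁆ L ⧸ I :=
    { (LieSubmodule.Quotient.mk' I : L →ₗ[ℂ] L ⧸ I) with map_lie' := fun {x y} => rfl }
  have hq : Function.Surjective q := LieSubmodule.Quotient.surjective_mk' I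
  have hker : q.ker = I := by
    ext x
    rw [LieHom.mem_ker]
    exact LieSubmodule.Quotient.mk_eq_zero (N := I)
  refine exists_congr fun k => ?_
  rw [← LieIdeal.derivedSeries_map_eq k hq, LieIdeal.map_eq_bot_iff, hker]

/-- The values of a vector field on the coordinates. -/
noncomputable def coordValues (n : ℕ) :
    FormalDer n →ₗ[FormalSeries n] (Fin n → FormalSeries n) where
  toFun δ i := δ (MvPowerSeries.X i)
  map_add' _ _ := rfl
  map_smul' _ _ := rfl

theorem coordValues_injective (n : ℕ) : Function.Injective (coordValues n) :=
  fun _ _ h => formalDer_ext fun i => congrFun h i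

theorem mem_pow_smul_top_pi {n : ℕ} {I : Ideal (FormalSeries n)} {v : Fin n → FormalSeries n}
    (h : ∀ i, v i ∈ I) : v ∈ I • (⊤ : Submodule (FormalSeries n) (Fin n → FormalSeries n)) := by
  rw [pi_eq_sum_univ v]
  exact Submodule.sum_mem _ fun i _ => Submodule.smul_mem_smul (h i) trivial

/-- Artin–Rees for `Der_f`, embedded in the free module of rank `n` by the values on the
coordinates. -/
theorem exists_mem_pow_smul_logDer {n : ℕ} (f : FormalSeries n) (d : ℕ) :
    ∃ k, ∀ δ ∈ logDer f, (∀ i, δ (MvPowerSeries.X i) ∈ maxIdeal n ^ k) →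
      δ ∈ maxIdeal n ^ d • logDer f := by
  obtain ⟨k, hk⟩ := (maxIdeal n).exists_pow_inf_eq_pow_smul ((logDer f).map (coordValues n))
  refine ⟨k + d, fun δ hδ h => ?_⟩
  have h1 : coordValues n δ ∈ maxIdeal n ^ (k + d) •
      (⊤ : Submodule (FormalSeries n) (Fin n → FormalSeries n)) ⊓ (logDer f).map (coordValues n) :=
    ⟨mem_pow_smul_top_pi h, δ, hδ, rfl⟩
  rw [hk _ (Nat.le_add_right k d), Nat.add_sub_cancel_left] at h1
  have h2 := Submodule.smul_mono le_rfl inf_le_right h1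
  rw [← Submodule.map_smul''] at h2
  obtain ⟨η, hη, he⟩ := h2
  rwa [← coordValues_injective n he]

theorem isSolvable_truncLie_of_diagFields_eq_bot {n : ℕ} (f : FormalSeries n)
    (hf : ¬ IsProduct f) (h : ∀ g, ContactEquiv f g → diagFields g = ⊥) (d : ℕ) :
    LieAlgebra.IsSolvable (TruncLie f hf d) := by
  have hf' := not_not.mp hf
  obtain ⟨k, hk⟩ := exists_mem_pow_smul_logDer f d
  rw [LieAlgebra.isSolvable_quotient_iff]
  obtain ⟨l, hl⟩ := LieHom.exists_derivedSeries_le_ker_of_isNilpotent (jetRep hf' k) fun δ => by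
    rcases exists_diagFields_ne_bot_or_isNilpotent δ.2 (hf' δ.2) with ⟨g, hg, hne⟩ | h1
    · exact absurd (h g hg) hne
    · exact h1 k
  refine ⟨l, hl.trans fun δ hδ => ?_⟩
  rw [LieHom.mem_ker, jetRep_eq_zero_iff] at hδ
  exact hk δ δ.2 fun i => hδ _

/-! ### Abelian plus a line, and reduction to `𝔇_1` -/

/-- A Lie algebra that is the sum of an abelian subalgebra and a line is solvable. -/
theorem LieAlgebra.isSolvable_of_abelian_add_line {g : Type*} [LieRing g] [LieAlgebra ℂ g]
    (A : Submodule ℂ g) (x : g) (hA : ∀ a ∈ A, ∀ b ∈ A, ⁅a, b⁆ = 0)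
    (hx : ∀ y, ∃ a ∈ A, ∃ t : ℂ, y = a + t • x) : LieAlgebra.IsSolvable g := by
  -- `B` is `[A, x]`, which contains all brackets; it remains to see that `B` is abelian.
  let B : Submodule ℂ g := Submodule.span ℂ {y | ∃ a ∈ A, ⁅a, x⁆ = y}
  have hbr : ∀ y z : g, ⁅y, z⁆ ∈ B := by
    intro y z
    obtain ⟨a, ha, s, rfl⟩ := hx y
    obtain ⟨b, hb, t, rfl⟩ := hx z
    have e : ⁅a + s • x, b + t • x⁆ = t • ⁅a, x⁆ - s • ⁅b, x⁆ := by
      rw [add_lie, lie_add, lie_add, hA a ha b hb, lie_smul, smul_lie, smul_lie, lie_smul,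
        lie_self, ← lie_skew b x]
      simp only [smul_zero, add_zero, zero_add, smul_neg, sub_eq_add_neg, neg_neg]
    rw [e]
    exact B.sub_mem (B.smul_mem _ (Submodule.subset_span ⟨a, ha, rfl⟩))
      (B.smul_mem _ (Submodule.subset_span ⟨b, hb, rfl⟩))
  have hgen : ∀ a ∈ A, ∀ b ∈ A, ⁅⁅a, x⁆, ⁅b, x⁆⁆ = 0 := by
    by_cases h : ∀ a ∈ A, ⁅a, x⁆ ∈ A
    · exact fun a ha b hb => hA _ (h a ha) _ (h b hb)
    · push Not at h
      obtain ⟨e, he, hne⟩ := h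
      obtain ⟨e', he', t, het⟩ := hx ⁅e, x⁆
      have ht : t ≠ 0 := by
        rintro rfl
        rw [zero_smul, add_zero] at het
        exact hne (het ▸ he')
      -- If `A` is not stable under bracketing with `x`, then `[A, x]` is a line: as `[e, b] = 0`,
      -- the Jacobi identity gives `[e, [b, x]] = [b, [e, x]]`, and comparing the `x`-components `s`
      -- and `t` yields `s [e, x] = t [b, x]` with `t ≠ 0`.
      have hmul : ∀ b ∈ A, ∃ c : ℂ, ⁅b, x⁆ = c • ⁅e, x⁆ := by
        intro b hb
        obtain ⟨b', hb', s, hs⟩ := hx ⁅b, x⁆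
        have h1 : ⁅e, ⁅b, x⁆⁆ = ⁅b, ⁅e, x⁆⁆ := by
          rw [leibniz_lie e b x, hA e he b hb, zero_lie, zero_add]
        have h2 : s • ⁅e, x⁆ = t • ⁅b, x⁆ := by
          rwa [hs, het, lie_add, lie_add, hA e he b' hb', hA b hb e' he', lie_smul, lie_smul,
            zero_add, zero_add] at h1
        exact ⟨t⁻¹ * s, by rw [mul_smul, h2, smul_smul, inv_mul_cancel₀ ht, one_smul]⟩
      intro a ha b hb
      obtain ⟨c, hc⟩ := hmul a ha
      obtain ⟨d, hd⟩ := hmul b hb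
      rw [hc, hd, smul_lie, lie_smul, lie_self, smul_zero, smul_zero]
  have hB : ∀ y ∈ B, ∀ z ∈ B, ⁅y, z⁆ = 0 := by
    intro y hy z hz
    induction hy, hz using Submodule.span_induction₂ with
    | mem_mem y z hy hz =>
      obtain ⟨a, ha, rfl⟩ := hy
      obtain ⟨b, hb, rfl⟩ := hz
      exact hgen a ha b hb
    | zero_left => rw [zero_lie]
    | zero_right => rw [lie_zero]
    | add_left _ _ _ _ _ _ h1 h2 => rw [add_lie, h1, h2, add_zero]
    | add_right _ _ _ _ _ _ h1 h2 => rw [lie_add, h1, h2, add_zero]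
    | smul_left _ _ _ _ _ h1 => rw [smul_lie, h1, smul_zero]
    | smul_right _ _ _ _ _ h1 => rw [lie_smul, h1, smul_zero]
  have h1 : ∀ y ∈ LieAlgebra.derivedSeries ℂ g 1, y ∈ B := by
    intro y hy
    rw [← LieSubmodule.mem_toSubmodule, LieAlgebra.derivedSeries_def,
      LieAlgebra.derivedSeriesOfIdeal_succ, LieAlgebra.derivedSeriesOfIdeal_zero,
      LieSubmodule.lieIdeal_oper_eq_linear_span'] at hy
    refine Submodule.span_le.mpr ?_ hy
    rintro _ ⟨a, _, b, _, rfl⟩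
    exact hbr a b
  refine LieAlgebra.IsSolvable.mk (R := ℂ) (k := 2) ?_
  rw [eq_bot_iff, LieAlgebra.derivedSeries_def, LieAlgebra.derivedSeriesOfIdeal_succ,
    LieSubmodule.lie_le_iff]
  intro y hy z hz
  rw [LieSubmodule.mem_bot]
  exact hB y (h1 y hy) z (h1 z hz)

theorem Submodule.exists_forall_eq_add_smul_of_finrank_le {V : Type*} [AddCommGroup V] [Module ℂ V]
    [FiniteDimensional ℂ V] (A : Submodule ℂ V)
    (h : Module.finrank ℂ V ≤ Module.finrank ℂ A + 1) :
    ∃ x : V, ∀ y, ∃ a ∈ A, ∃ t : ℂ, y = a + t • x := by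
  by_cases hA : A = ⊤
  · exact ⟨0, fun y => ⟨y, by rw [hA]; trivial, 0, by simp⟩⟩
  · obtain ⟨x, hx⟩ : ∃ x, x ∉ A := by
      by_contra! hh
      exact hA (eq_top_iff.mpr fun y _ => hh y)
    have hlt : A < A ⊔ Submodule.span ℂ {x} := by
      refine lt_of_le_of_ne le_sup_left fun he => hx ?_
      rw [he]
      exact Submodule.mem_sup_right (Submodule.mem_span_singleton_self x)
    have htop : A ⊔ Submodule.span ℂ {x} = ⊤ := by
      apply Submodule.eq_top_of_finrank_eq
      have h1 := Submodule.finrank_lt_finrank_of_lt hlt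
      have h2 := Submodule.finrank_le (A ⊔ Submodule.span ℂ {x})
      omega
    refine ⟨x, fun y => ?_⟩
    obtain ⟨a, ha, z, hz, rfl⟩ := Submodule.mem_sup.mp (htop ▸ (Submodule.mem_top : y ∈ ⊤))
    obtain ⟨t, rfl⟩ := Submodule.mem_span_singleton.mp hz
    exact ⟨a, ha, t, rfl⟩

theorem LieAlgebra.isSolvable_of_finrank_le_abelian_add_one {g : Type*} [LieRing g]
    [LieAlgebra ℂ g] [FiniteDimensional ℂ g] (A : Submodule ℂ g)
    (hA : ∀ a ∈ A, ∀ b ∈ A, ⁅a, b⁆ = 0) (h : Module.finrank ℂ g ≤ Module.finrank ℂ A + 1) :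
    LieAlgebra.IsSolvable g := by
  obtain ⟨x, hx⟩ := A.exists_forall_eq_add_smul_of_finrank_le h
  exact LieAlgebra.isSolvable_of_abelian_add_line A x hA hx

theorem pow_smul_logDer_le {A : Type} [CommRing A] [Algebra ℂ A] {f : A} {I : Ideal A}
    (hf : logDer f ≤ I • (⊤ : Submodule A (Derivation ℂ A A))) (d : ℕ) :
    I ^ d • logDer f ≤ I ^ (d + 1) • (⊤ : Submodule A (Derivation ℂ A A)) := by
  rw [pow_succ, mul_smul]
  exact Submodule.smul_mono le_rfl hf

/-- In `[δ, b θ] = b [δ, θ] + δ(b) θ` with `b ∈ I`, the first term gains the factor `b`; the second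
gains a power because `Der_f ⊆ I · Der` puts the values of `δ` in `I ^ (d + 1)`. -/
theorem lie_mem_truncIdeal_succ {A : Type} [CommRing A] [Algebra ℂ A] {f : A} {I : Ideal A}
    (hf : logDer f ≤ I • (⊤ : Submodule A (Derivation ℂ A A))) (d : ℕ)
    {δ η : logDerLie f} (hδ : δ ∈ truncIdeal f I hf d) (hη : η ∈ truncIdeal f I hf 1) :
    ⁅δ, η⁆ ∈ truncIdeal f I hf (d + 1) := by
  obtain ⟨δ, hδf⟩ := δ
  obtain ⟨η, hηf⟩ := η
  change η ∈ I ^ 1 • logDer f at hη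
  change ⁅δ, η⁆ ∈ I ^ (d + 1) • logDer f
  have hδ' : δ ∈ I ^ d • logDer f := hδ
  have hval : ∀ b, δ b ∈ I ^ (d + 1) := apply_mem_of_mem_smul_top (pow_smul_logDer_le hf d hδ')
  rw [pow_one] at hη
  clear hηf
  induction hη using Submodule.smul_induction_on' with
  | smul b hb θ hθ =>
    have key : ⁅δ, b • θ⁆ = b • ⁅δ, θ⁆ + δ b • θ := by
      refine Derivation.ext fun g => ?_
      simp only [Derivation.commutator_apply, Derivation.coe_smul, Derivation.coe_add,
        Pi.smul_apply, Pi.add_apply, Derivation.leibniz, smul_eq_mul]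
      ring
    rw [key]
    refine Submodule.add_mem _ ?_ (Submodule.smul_mem_smul (hval b) hθ)
    rw [pow_succ', mul_smul]
    exact Submodule.smul_mem_smul hb
      (lie_mem_left ℂ _ (truncIdeal f I hf d) ⟨δ, hδf⟩ ⟨θ, hθ⟩ hδ)
  | add a _ b _ h1 h2 => rw [lie_add]; exact Submodule.add_mem _ h1 h2

theorem smul_sub_smul_mem_smul {A M : Type*} [CommRing A] [AddCommGroup M] [Module A M]
    {I : Ideal A} {N : Submodule A M} {a b : A} {x : M} (h : a - b ∈ I) (hx : x ∈ N) :
    a • x - b • x ∈ I • N := by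
  rw [← sub_smul]
  exact Submodule.smul_mem_smul h hx

theorem isSolvable_truncLie_of_isSolvable_truncLie_one {n : ℕ} (f : FormalSeries n)
    (hf : ¬ IsProduct f) (h : LieAlgebra.IsSolvable (TruncLie f hf 1)) (d : ℕ) :
    LieAlgebra.IsSolvable (TruncLie f hf d) := by
  obtain ⟨k, hk⟩ := (LieAlgebra.isSolvable_quotient_iff _).mp h
  rw [LieAlgebra.isSolvable_quotient_iff]
  -- Once the derived series has entered `𝔪 · Der_f`, each further step gains one power of `𝔪`.
  have key : ∀ j, LieAlgebra.derivedSeries ℂ (logDerLie f) (k + j) ≤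
      truncIdeal f (maxIdeal n) (not_not.mp hf) (j + 1) := by
    intro j
    induction j with
    | zero => exact hk
    | succ j ih =>
      rw [← add_assoc, LieAlgebra.derivedSeries_def, LieAlgebra.derivedSeriesOfIdeal_succ,
        LieSubmodule.lie_le_iff]
      intro x hx y hy
      exact lie_mem_truncIdeal_succ _ (j + 1) (ih hx)
        (hk (LieAlgebra.derivedSeriesOfIdeal_antitone ⊤ (Nat.le_add_right k j) hy))
  refine ⟨k + d, (key d).trans fun δ hδ => ?_⟩
  change (δ : FormalDer n) ∈ maxIdeal n ^ (d + 1) • logDer f at hδ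
  exact Submodule.smul_mono (Ideal.pow_le_pow_right (Nat.le_succ d)) le_rfl hδ

/-! ### Diagonal fields inside `𝔇_1` and the dimension count -/

/-- Conjugation of vector fields by a coordinate change. -/
noncomputable def conjDer {n : ℕ} (φ : FormalSeries n ≃ₐ[ℂ] FormalSeries n) :
    FormalDer n →ₗ[ℂ] FormalDer n where
  toFun σ := Derivation.mk' (φ.symm.toLinearMap ∘ₗ (σ : FormalSeries n →ₗ[ℂ] FormalSeries n) ∘ₗ
    φ.toLinearMap) fun a b => by
      change φ.symm (σ (φ (a * b))) = a * φ.symm (σ (φ b)) + b * φ.symm (σ (φ a))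
      rw [map_mul, Derivation.leibniz, map_add, smul_eq_mul, smul_eq_mul, map_mul, map_mul,
        AlgEquiv.symm_apply_apply, AlgEquiv.symm_apply_apply]
  map_add' σ τ := Derivation.ext fun a => map_add φ.symm (σ (φ a)) (τ (φ a))
  map_smul' c σ := Derivation.ext fun a => map_smul φ.symm c (σ (φ a))

theorem conjDer_apply {n : ℕ} (φ : FormalSeries n ≃ₐ[ℂ] FormalSeries n) (σ : FormalDer n)
    (a : FormalSeries n) : conjDer φ σ a = φ.symm (σ (φ a)) := rfl

theorem conjDer_lie {n : ℕ} (φ : FormalSeries n ≃ₐ[ℂ] FormalSeries n) (σ τ : FormalDer n) :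
    ⁅conjDer φ σ, conjDer φ τ⁆ = conjDer φ ⁅σ, τ⁆ := by
  refine Derivation.ext fun a => ?_
  simp only [Derivation.commutator_apply, conjDer_apply, AlgEquiv.apply_symm_apply, map_sub]

theorem conjDer_mem_logDer {n : ℕ} {f : FormalSeries n}
    (φ : FormalSeries n ≃ₐ[ℂ] FormalSeries n) (u : (FormalSeries n)ˣ) {σ : FormalDer n}
    (hσ : σ ∈ logDer (u * φ f)) : conjDer φ σ ∈ logDer f := by
  intro q hq
  obtain ⟨a, rfl⟩ := Ideal.mem_span_singleton'.mp hq
  have h1 : φ (a * f) ∈ Ideal.span {(u * φ f : FormalSeries n)} :=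
    Ideal.mem_span_singleton'.mpr ⟨φ a * (u⁻¹ : (FormalSeries n)ˣ), by
      rw [map_mul, mul_assoc, Units.inv_mul_cancel_left]⟩
  obtain ⟨b, hb⟩ := Ideal.mem_span_singleton'.mp (hσ _ h1)
  rw [conjDer_apply, ← hb, map_mul, map_mul, AlgEquiv.symm_apply_apply, ← mul_assoc]
  exact Ideal.mul_mem_left _ _ (Ideal.mem_span_singleton_self f)

theorem lie_eq_zero_of_isDiagonal {n : ℕ} {σ τ : FormalDer n} (hσ : IsDiagonal σ)
    (hτ : IsDiagonal τ) : ⁅σ, τ⁆ = 0 := by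
  obtain ⟨v, hv⟩ := hσ
  obtain ⟨w, hw⟩ := hτ
  refine formalDer_ext fun i => ?_
  rw [Derivation.commutator_apply, hv, hw, σ.map_smul, τ.map_smul, hv, hw, smul_comm, sub_self]
  rfl

theorem IsDiagonal.eq_zero_of_mem_sq {n : ℕ} {σ : FormalDer n} (hσ : IsDiagonal σ)
    (h : ∀ i, σ (MvPowerSeries.X i) ∈ maxIdeal n ^ 2) : σ = 0 := by
  obtain ⟨w, hw⟩ := hσ
  refine formalDer_ext fun i => ?_
  have h1 := (mem_maxIdeal_pow_iff _ _).mp (h i) (Finsupp.single i 1) (by simp)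
  rw [hw, map_smul] at h1
  have h2 : w i = 0 := by simpa using h1
  rw [hw, h2, zero_smul]
  rfl

/-- The diagonal vector fields of a divisor contact equivalent to `f`, as elements of
`Der_f / 𝔪 · Der_f`. -/
noncomputable def diagToTrunc {n : ℕ} (f : FormalSeries n) (hf : ¬ IsProduct f)
    (φ : FormalSeries n ≃ₐ[ℂ] FormalSeries n) (u : (FormalSeries n)ˣ) :
    diagFields ((u : FormalSeries n) * φ f) →ₗ[ℂ] TruncLie f hf 1 :=
  (LieSubmodule.Quotient.mk' (truncIdeal f (maxIdeal n) (not_not.mp hf) 1) :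
    logDerLie f →ₗ[ℂ] TruncLie f hf 1) ∘ₗ
  { toFun := fun σ => (⟨conjDer φ σ, conjDer_mem_logDer φ u σ.2.1⟩ : logDerLie f)
    map_add' := fun σ τ => Subtype.ext (map_add (conjDer φ) (σ : FormalDer n) τ)
    map_smul' := fun c σ => Subtype.ext (map_smul (conjDer φ) c (σ : FormalDer n)) }

/-- As `f` is not a product, `𝔪 · Der_f ⊆ 𝔪 ^ 2 · Der`, whereas a nonzero diagonal field has a
nonzero linear part. -/
theorem diagToTrunc_injective {n : ℕ} (f : FormalSeries n) (hf : ¬ IsProduct f)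
    (φ : FormalSeries n ≃ₐ[ℂ] FormalSeries n) (u : (FormalSeries n)ˣ) :
    Function.Injective (diagToTrunc f hf φ u) := by
  rw [injective_iff_map_eq_zero]
  rintro ⟨σ, hσ⟩ h
  have h1 : conjDer φ σ ∈ maxIdeal n ^ 1 • logDer f :=
    (LieSubmodule.Quotient.mk_eq_zero
      (N := truncIdeal f (maxIdeal n) (not_not.mp hf) 1)).mp h
  have h2 : conjDer φ σ ∈ maxIdeal n ^ 2 • (⊤ : Submodule (FormalSeries n) (FormalDer n)) :=
    pow_smul_logDer_le (not_not.mp hf) 1 h1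
  refine Subtype.ext (hσ.2.1.eq_zero_of_mem_sq fun i => ?_)
  have h3 := (AlgEquiv.mem_maxIdeal_pow_iff φ 2 _).mpr
    (apply_mem_of_mem_smul_top h2 (φ.symm (MvPowerSeries.X i)))
  simpa [conjDer_apply] using h3

theorem diagToTrunc_lie {n : ℕ} (f : FormalSeries n) (hf : ¬ IsProduct f)
    (φ : FormalSeries n ≃ₐ[ℂ] FormalSeries n) (u : (FormalSeries n)ˣ)
    (σ τ : diagFields ((u : FormalSeries n) * φ f)) : ⁅diagToTrunc f hf φ u σ, diagToTrunc f hf φ u τ⁆ = 0 := by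
  have h : (⁅(⟨conjDer φ σ, conjDer_mem_logDer φ u σ.2.1⟩ : logDerLie f),
      ⟨conjDer φ τ, conjDer_mem_logDer φ u τ.2.1⟩⁆ : logDerLie f) = 0 := by
    refine Subtype.ext ?_
    change ⁅conjDer φ σ, conjDer φ τ⁆ = 0
    rw [conjDer_lie, lie_eq_zero_of_isDiagonal σ.2.2.1 τ.2.2.1, map_zero]
  exact (LieSubmodule.Quotient.mk_bracket _ _ _).symm.trans
    (congrArg (LieSubmodule.Quotient.mk' (truncIdeal f (maxIdeal n) (not_not.mp hf) 1)) h)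

/-- Modulo `𝔪 · Der_f` only the constant terms of the coefficients matter, so `k` generators bound
the dimension of `𝔇_1` by `k`. -/
theorem exists_surjective_truncLie_one {n k : ℕ} (f : FormalSeries n) (hf : ¬ IsProduct f)
    (δ : Fin k → FormalDer n)
    (hδ : Submodule.span (FormalSeries n) (Set.range δ) = logDer f) :
    ∃ p : (Fin k → ℂ) →ₗ[ℂ] TruncLie f hf 1, Function.Surjective p := by
  have hmem : ∀ i, δ i ∈ logDer f := fun i => hδ ▸ Submodule.subset_span ⟨i, rfl⟩
  let q : logDerLie f →ₗ[ℂ] TruncLie f hf 1 :=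
    LieSubmodule.Quotient.mk' (truncIdeal f (maxIdeal n) (not_not.mp hf) 1)
  refine ⟨q ∘ₗ Fintype.linearCombination ℂ fun i => (⟨δ i, hmem i⟩ : logDerLie f), fun x => ?_⟩
  obtain ⟨⟨η, hη⟩, rfl⟩ := LieSubmodule.Quotient.surjective_mk'
    (truncIdeal f (maxIdeal n) (not_not.mp hf) 1) x
  have hη' : η ∈ Submodule.span (FormalSeries n) (Set.range δ) := hδ ▸ hη
  obtain ⟨a, rfl⟩ := (Submodule.mem_span_range_iff_exists_fun _).mp hη'
  refine ⟨fun i => MvPowerSeries.constantCoeff (a i), ?_⟩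
  rw [← sub_eq_zero]
  change q (Fintype.linearCombination ℂ (fun i => (⟨δ i, hmem i⟩ : logDerLie f)) _) - q _ = 0
  rw [← map_sub]
  refine (LieSubmodule.Quotient.mk_eq_zero
    (N := truncIdeal f (maxIdeal n) (not_not.mp hf) 1)).mpr ?_
  rw [← neg_mem_iff, neg_sub]
  change (_ : FormalDer n) ∈ maxIdeal n ^ 1 • logDer f
  rw [pow_one]
  have e : (Fintype.linearCombination ℂ (fun i => (⟨δ i, hmem i⟩ : logDerLie f))
      (fun i => MvPowerSeries.constantCoeff (a i)) : FormalDer n) =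
      ∑ i, (algebraMap ℂ (FormalSeries n) (MvPowerSeries.constantCoeff (a i))) • δ i := by
    rw [Fintype.linearCombination_apply]
    refine (map_sum (logDerLie f).toSubmodule.subtype _ _).trans ?_
    refine Finset.sum_congr rfl fun i _ => ?_
    rw [algebraMap_smul]
    rfl
  change ∑ i, a i • δ i - (Fintype.linearCombination ℂ (fun i => (⟨δ i, hmem i⟩ : logDerLie f))
      (fun i => MvPowerSeries.constantCoeff (a i)) : FormalDer n) ∈ _
  rw [e, ← Finset.sum_sub_distrib]
  refine Submodule.sum_mem _ fun i _ => ?_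
  exact smul_sub_smul_mem_smul (sub_constantCoeff_mem_maxIdeal (a i)) (hmem i)

theorem isSolvable_truncLie_of_generators {n k : ℕ} (f : FormalSeries n) (hf : ¬ IsProduct f)
    (δ : Fin k → FormalDer n) (hδ : Submodule.span (FormalSeries n) (Set.range δ) = logDer f)
    {g : FormalSeries n} (hg : ContactEquiv f g)
    (hk : k ≤ Module.finrank ℂ (diagFields g) + 1) (d : ℕ) :
    LieAlgebra.IsSolvable (TruncLie f hf d) := by
  obtain ⟨φ, u, rfl⟩ := hg
  refine isSolvable_truncLie_of_isSolvable_truncLie_one f hf ?_ d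
  obtain ⟨p, hp⟩ := exists_surjective_truncLie_one f hf δ hδ
  have hfin : FiniteDimensional ℂ (TruncLie f hf 1) := Module.Finite.of_surjective p hp
  refine LieAlgebra.isSolvable_of_finrank_le_abelian_add_one
    (LinearMap.range (diagToTrunc f hf φ u)) ?_ ?_
  · rintro _ ⟨σ, rfl⟩ _ ⟨τ, rfl⟩
    exact diagToTrunc_lie f hf φ u σ τ
  · rw [LinearMap.finrank_range_of_inj (diagToTrunc_injective f hf φ u)]
    have := LinearMap.finrank_le_finrank_of_surjective hp
    rw [Module.finrank_fin_fun] at this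
    exact this.trans hk

/-- Finiteness ensures that `finrank` equal to `0` means the zero space and is not a default value.
-/
instance finiteDimensional_diagFields {n : ℕ} (g : FormalSeries n) :
    FiniteDimensional ℂ (diagFields g) := by
  let c : diagFields g →ₗ[ℂ] (Fin n → ℂ) :=
    LinearMap.pi fun i => MvPowerSeries.coeff (Finsupp.single i 1) ∘ₗ
      { toFun := fun σ => (σ : FormalDer n) (MvPowerSeries.X i)
        map_add' := fun _ _ => rfl
        map_smul' := fun _ _ => rfl }
  refine Module.Finite.of_injective c fun σ τ h => ?_
  obtain ⟨v, hv⟩ := σ.2.2.1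
  obtain ⟨w, hw⟩ := τ.2.2.1
  refine Subtype.ext (formalDer_ext fun i => ?_)
  have h1 : MvPowerSeries.coeff (Finsupp.single i 1) ((σ : FormalDer n) (MvPowerSeries.X i)) =
      MvPowerSeries.coeff (Finsupp.single i 1) ((τ : FormalDer n) (MvPowerSeries.X i)) :=
    congrFun h i
  rw [hv, hw, map_smul, map_smul] at h1
  have h2 : v i = w i := by simpa using h1
  rw [hv, hw, h2]

theorem proposition17 {n : ℕ} (f : FormalSeries n) (hf0 : f ≠ 0) (hf : ¬ IsProduct f) :
    (∀ s : ℕ, IsMaxMultihomogeneity f s →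
      ((∃ r : ℕ, (∃ δ : Fin (s + r) → FormalDer n, IsMinimalGenerators f δ) ∧ r ≤ 1) ∨ s = 0) →
        ∀ d : ℕ, 1 ≤ d → LieAlgebra.IsSolvable (TruncLie f hf d)) ∧
    (Module.Free (FormalSeries n) (logDer f) → Module.finrank (FormalSeries n) (logDer f) = 2 →
        ∀ d : ℕ, 1 ≤ d → LieAlgebra.IsSolvable (TruncLie f hf d)) := by
  constructor
  · rintro s ⟨⟨g, hg, hs⟩, hmax⟩ (⟨r, ⟨δ, hδ, _⟩, hr⟩ | rfl) d _
    · exact isSolvable_truncLie_of_generators f hf δ hδ hg (by omega) d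
    · refine isSolvable_truncLie_of_diagFields_eq_bot f hf (fun g' hg' => ?_) d
      exact Submodule.finrank_eq_zero.mp (Nat.le_zero.mp (hmax ⟨g', hg', rfl⟩))
  · intro hfree hrank d _
    -- A nonzero space of diagonal fields has dimension at least `1`, so the two basis elements meet
    -- the bound `2 ≤ 1 + 1`.
    by_cases h : ∀ g, ContactEquiv f g → diagFields g = ⊥
    · exact isSolvable_truncLie_of_diagFields_eq_bot f hf h d
    · push Not at h
      obtain ⟨g, hg, hne⟩ := h
      have hpos : 0 < Module.finrank ℂ (diagFields g) :=
        Nat.pos_of_ne_zero fun h0 => hne (Submodule.finrank_eq_zero.mp h0)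
      have : Module.Finite (FormalSeries n) (logDer f) :=
        Module.finite_of_finrank_pos (by omega)
      let b := Module.finBasisOfFinrankEq (FormalSeries n) (logDer f) hrank
      refine isSolvable_truncLie_of_generators f hf (fun i => (b i : FormalDer n)) ?_ hg
        (by omega) d
      have := congrArg (Submodule.map (logDer f).subtype) b.span_eq
      rwa [Submodule.map_span, Submodule.map_top, Submodule.range_subtype, ← Set.range_comp] at this
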